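/- **Model.** An advertiser invests at $N\ge 1$ sites. Site $n$ runs through consecutive frames $k=0,1,2,\dots$, the first one starting at time $0$. At the start of frame $k$ the advertiser chooses, from the information available at that time (and possibly randomizing), an investment and freeze time $(p_n[k],T^{\mathrm{fr}}_n[k])\in\mathcal P_n$ and a configuration $m_n[k]\in\mathcal M_n$; the frame consists of an advertising interval of random length $T^{\mathrm{ad}}_n[k]\ge 0$, yielding a random revenue $R_n[k]$, followed by a freeze interval of length $T^{\mathrm{fr}}_n[k]$. Given the information available at the start of the frame, $(T^{\mathrm{ad}}_n[k],R_n[k])$ has a law determined by $(n,p_n[k],m_n[k])$, with means $F_n(p,m)$ and $G_n(p,m)$. Each $\mathcal P_n$ contains a pair with $p=0$, and for all feasible actions $0\le p\le p_n^{\max}$, $T^{\mathrm{fr}}\ge 0$, $0<T_n^{\min}\le T^{\mathrm{ad}}+T^{\mathrm{fr}}\le T_n^{\max}$ and $|R|\le R_n^{\max}$ almost surely, and $0\le G_n(p,m)\le \nu p$ with a constant $\nu\ge 0$. Let $T^{\max}=\max_n T_n^{\max}$, $T^{\min}=\min_n T_n^{\min}$, let $B_{\mathrm{av}}\ge 0$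 be the budget, and put $$C_0=\tfrac12 (T^{\max})^2\Big[\Big(\sum_n \tfrac{p_n^{\max}}{T_n^{\min}}\Big)^2+B_{\mathrm{av}}^2\Big],\qquad C_1=2T^{\max}\sum_n\tfrac{p_n^{\max}}{T_n^{\min}},\qquad c_{\max}=T^{\max}\max\Big[\sum_n\tfrac{p_n^{\max}}{T_n^{\min}},B_{\mathrm{av}}\Big].$$ The time average revenue and expenditure of a strategy are $$\mathrm{Profit}_{\mathrm{av}}=\sum_n\frac{\lim_K\frac1K\sum_{k<K}R_n[k]}{\lim_K\frac1K\sum_{k<K}(T^{\mathrm{ad}}_n[k]+T^{\mathrm{fr}}_n[k])},\qquad \mathrm{Cost}_{\mathrm{av}}=\sum_n\frac{\lim_K\frac1K\sum_{k<K}p_n[k]}{\lim_K\frac1K\sum_{k<K}(T^{\mathrm{ad}}_n[k]+T^{\mathrm{fr}}_n[k])},$$ all limits being assumed to exist with probability $1$ for every strategy considered. A strategy is feasible if $\mathrm{Cost}_{\mathrm{av}}\le B_{\mathrm{av}}$ with probability $1$; $\mathrm{Profit}^*_{\mathrm{av}}$ is the supremum of the (expected) time average revenue over all feasible strategies. **Algorithm.**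 Let $0=t_0<t_1<\cdots$ be the times at which at least one site starts a frame, $\delta_d=t_{d+1}-t_d$, let $k_n(t)$ be the number of frames completed by site $n$ up to time $t$, and let $a_n[t_d]=p_n[k]/(F_n(p_n[k],m_n[k])+T^{\mathrm{fr}}_n[k])$ with $k=k_n(t_d)$. The virtual deficit queue is $Q(t_0)=0$, $Q(t_{d+1})=\max[Q(t_d)-\delta_dB_{\mathrm{av}},0]+\delta_d\sum_n a_n[t_d]$. The Ad-Investment (AI) algorithm with parameter $V\ge 1$ gives each site $n$ that starts a frame at $t_d$ an action $(p,T^{\mathrm{fr}},m)$ that maximizes $$\frac{V G_n(p,m)-Q(t_d)\,p}{F_n(p,m)+T^{\mathrm{fr}}}$$ over $(p,T^{\mathrm{fr}})\in\mathcal P_n$, $m\in\mathcal M_n$. **Theorem.** Under the AI algorithm with parameter $V\ge 1$, with probability $1$: (a) $\displaystyle \mathrm{Profit}^{\mathrm{AI}}_{\mathrm{av}}\ \ge\ \mathrm{Profit}^*_{\mathrm{av}}-\frac{C_1}{V}-\frac{C_0}{V\,T^{\min}}$, where $\mathrm{Profit}^*_{\mathrm{av}}$ is finite; (b) $Q(t_d)\le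 V\nu+2c_{\max}$ for every $d\ge0$, and the average budget constraint $\mathrm{Cost}_{\mathrm{av}}\le B_{\mathrm{av}}$ holds. Since $C_0$, $C_1$, $c_{\max}$ and $\nu$ do not depend on $V$, the revenue gap is $O(1/V)$ and the deficit is $O(V)$. -/

import Mathlib

open MeasureTheory ProbabilityTheory Filter Topology

universe u v

/-! ### The system -/

/-- The environment: `N` sponsored search sites. The elements of `Cfg n` are the feasible operation
configurations of site `n` (the set `𝓜ₙ`). Durations, money and revenue are real numbers. -/
structure AdSystem (N : ℕ) (Cfg : Fin N → Type u) [∀ n, MeasurableSpace (Cfg n)] where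
  /-- the feasible (investment, freeze time) pairs `𝓟ₙ` -/
  actions : Fin N → Set (ℝ × ℝ)
  /-- the law of the pair (depletion time, revenue) = `(Tᵃᵈ, R)` of one advertising interval at
  site `n`, given the investment `p` and the configuration `m` -/
  law : ∀ n, Kernel (ℝ × Cfg n) (ℝ × ℝ)
  /-- the largest investment `pₙᵐᵃˣ` -/
  pMax : Fin N → ℝ
  /-- the lower bound `Tₙᵐⁱⁿ` on the frame length -/
  frameMin : Fin N → ℝ
  /-- the upper bound `Tₙᵐᵃˣ` on the frame length -/
  frameMax : Fin N → ℝ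
  /-- the bound `Rₙᵐᵃˣ` on the revenue of one advertising interval -/
  revMax : Fin N → ℝ
  /-- the revenue-per-investment constant `ν` -/
  nu : ℝ
  /-- the average budget `B_av` -/
  budget : ℝ
  law_markov : ∀ n, IsMarkovKernel (law n)
  /-- not investing is always an option -/
  zero_option : ∀ n, ∃ T, ((0 : ℝ), T) ∈ actions n
  invest_bounds : ∀ n p T, (p, T) ∈ actions n → 0 ≤ p ∧ p ≤ pMax n
  freeze_nonneg : ∀ n p T, (p, T) ∈ actions n → 0 ≤ T
  frameMin_pos : ∀ n, 0 < frameMin n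
  /-- depletion times are nonnegative, and under any feasible action the frame length
  `Tᵃᵈ + Tᶠʳ` lies between `Tₙᵐⁱⁿ` and `Tₙᵐᵃˣ` -/
  frame_bounds : ∀ n p T (m : Cfg n), (p, T) ∈ actions n →
    ∀ᵐ z ∂(law n (p, m)), 0 ≤ z.1 ∧ frameMin n ≤ z.1 + T ∧ z.1 + T ≤ frameMax n
  revenue_bound : ∀ n p T (m : Cfg n), (p, T) ∈ actions n →
    ∀ᵐ z ∂(law n (p, m)), |z.2| ≤ revMax n
  /-- the mean revenue `Gₙ(p, m)` satisfies `0 ≤ Gₙ(p, m) ≤ ν p` (so `Gₙ(0, m) = 0`) -/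
  mean_revenue : ∀ n p T (m : Cfg n), (p, T) ∈ actions n →
    0 ≤ ∫ z, z.2 ∂(law n (p, m)) ∧ ∫ z, z.2 ∂(law n (p, m)) ≤ nu * p
  nu_nonneg : 0 ≤ nu
  budget_nonneg : 0 ≤ budget

namespace AdSystem

variable {N : ℕ} {Cfg : Fin N → Type u} [∀ n, MeasurableSpace (Cfg n)] (sys : AdSystem N Cfg)

/-- `Fₙ(p, m)`, the mean depletion time. -/
noncomputable def F (n : Fin N) (p : ℝ) (m : Cfg n) : ℝ := ∫ z, z.1 ∂(sys.law n (p, m))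

/-- `Gₙ(p, m)`, the mean revenue. -/
noncomputable def G (n : Fin N) (p : ℝ) (m : Cfg n) : ℝ := ∫ z, z.2 ∂(sys.law n (p, m))

/-- `Tᵐᵃˣ = maxₙ Tₙᵐᵃˣ`. -/
noncomputable def Tmax [NeZero N] : ℝ := Finset.univ.sup' Finset.univ_nonempty sys.frameMax

/-- `Tᵐⁱⁿ = minₙ Tₙᵐⁱⁿ`. -/
noncomputable def Tmin [NeZero N] : ℝ := Finset.univ.inf' Finset.univ_nonempty sys.frameMin

/-- `∑ₙ pₙᵐᵃˣ / Tₙᵐⁱⁿ`. -/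
noncomputable def maxRate : ℝ := ∑ n, sys.pMax n / sys.frameMin n

/-- `c_max = Tᵐᵃˣ max(∑ₙ pₙᵐᵃˣ / Tₙᵐⁱⁿ, B_av)`. -/
noncomputable def cMax [NeZero N] : ℝ := sys.Tmax * max sys.maxRate sys.budget

/-- `C₀ = ½ (Tᵐᵃˣ)² ((∑ₙ pₙᵐᵃˣ / Tₙᵐⁱⁿ)² + B_av²)`. -/
noncomputable def C0 [NeZero N] : ℝ :=
  1 / 2 * sys.Tmax ^ 2 * (sys.maxRate ^ 2 + sys.budget ^ 2)

/-- `C₁ = 2 Tᵐᵃˣ ∑ₙ pₙᵐᵃˣ / Tₙᵐⁱⁿ`. -/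
noncomputable def C1 [NeZero N] : ℝ := 2 * sys.Tmax * sys.maxRate

/-- The objective `(V Gₙ(p, m) - q p) / (Fₙ(p, m) + T)` at deficit `q`. -/
noncomputable def Psi (n : Fin N) (V q p T : ℝ) (m : Cfg n) : ℝ :=
  (V * sys.G n p m - q * p) / (sys.F n p m + T)

end AdSystem

/-! ### Strategies and the processes they generate -/

/-- The time at which frame `k` of site `n` begins: all sites begin frame `0` at time `0`, and a
frame is an advertising interval followed by a freeze interval. -/
noncomputable def frameStart {N : ℕ} {Ω : Type v} (Tad Tfr : Fin N → ℕ → Ω → ℝ)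
    (n : Fin N) (k : ℕ) (ω : Ω) : ℝ :=
  ∑ j ∈ Finset.range k, (Tad n j ω + Tfr n j ω)

/-- A (nonanticipating, possibly randomized and history dependent) investment strategy together
with the outcomes it generates. `info t` is the information available at time `t`. At the beginning
of a frame of a site, a feasible action is chosen on the basis of the information available at that
time; given that information, the pair (depletion time, revenue) of the frame has the law that
belongs to the chosen investment and configuration. -/
structure AdProcess {N : ℕ} {Cfg : Fin N → Type u} [∀ n, MeasurableSpace (Cfg n)]
    (sys : AdSystem N Cfg) {Ω : Type v} [mΩ : MeasurableSpace Ω] (P : Measure Ω) where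
  /-- the investment `pₙ[k]` -/
  p : Fin N → ℕ → Ω → ℝ
  /-- the freeze time `Tₙᶠʳ[k]` -/
  Tfr : Fin N → ℕ → Ω → ℝ
  /-- the configuration `mₙ[k]` -/
  cfg : ∀ n : Fin N, ℕ → Ω → Cfg n
  /-- the depletion time `Tₙᵃᵈ[k]` -/
  Tad : Fin N → ℕ → Ω → ℝ
  /-- the revenue `Rₙ[k]` -/
  R : Fin N → ℕ → Ω → ℝ
  /-- the information available over time -/
  info : Filtration ℝ mΩ
  Tad_nonneg : ∀ n k ω, 0 ≤ Tad n k ω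
  feasible : ∀ n k ω, (p n k ω, Tfr n k ω) ∈ sys.actions n
  /-- it is known at every time which frames have begun -/
  isStoppingTime_start : ∀ n k,
    IsStoppingTime info (fun ω => ((frameStart Tad Tfr n k ω : ℝ) : WithTop ℝ))
  measurable_p : ∀ n k, Measurable[(isStoppingTime_start n k).measurableSpace] (p n k)
  measurable_Tfr : ∀ n k, Measurable[(isStoppingTime_start n k).measurableSpace] (Tfr n k)
  measurable_cfg : ∀ n k, Measurable[(isStoppingTime_start n k).measurableSpace] (cfg n k)
  /-- the revenue of a frame is known at the end of the frame -/
  measurable_R : ∀ n k, Measurable[(isStoppingTime_start n (k + 1)).measurableSpace] (R n k)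
  /-- the conditional law of the outcome of a frame -/
  outcome_law : ∀ n k (s : Set (ℝ × ℝ)), MeasurableSet s →
    P⟦(fun ω => (Tad n k ω, R n k ω)) ⁻¹' s | (isStoppingTime_start n k).measurableSpace⟧
      =ᵐ[P] fun ω => (sys.law n (p n k ω, cfg n k ω)).real s

/-- `lim_{K → ∞} (1/K) ∑_{k < K} f k`, meaningful if the limit exists. -/
noncomputable def timeAverage (f : ℕ → ℝ) : ℝ :=
  limUnder atTop (fun K : ℕ => (1 / (K : ℝ)) * ∑ k ∈ Finset.range K, f k)

/-- The limit `lim_{K → ∞} (1/K) ∑_{k < K} f k` exists in `ℝ`. -/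
def HasTimeAverage (f : ℕ → ℝ) : Prop :=
  ∃ a : ℝ, Tendsto (fun K : ℕ => (1 / (K : ℝ)) * ∑ k ∈ Finset.range K, f k) atTop (𝓝 a)

namespace AdProcess

variable {N : ℕ} {Cfg : Fin N → Type u} [∀ n, MeasurableSpace (Cfg n)] {sys : AdSystem N Cfg}
  {Ω : Type v} [MeasurableSpace Ω] {P : Measure Ω} (X : AdProcess sys P)

/-- The beginning of frame `k` of site `n`. -/
noncomputable def start (n : Fin N) (k : ℕ) (ω : Ω) : ℝ := frameStart X.Tad X.Tfr n k ω

/-- All time averages of revenue, investment and frame length exist on the sample path `ω`. -/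
def LimitsExist (ω : Ω) : Prop :=
  ∀ n, HasTimeAverage (fun k => X.R n k ω) ∧ HasTimeAverage (fun k => X.p n k ω) ∧
    HasTimeAverage (fun k => X.Tad n k ω + X.Tfr n k ω)

/-- The time average revenue `Profit_av`. -/
noncomputable def profit (ω : Ω) : ℝ :=
  ∑ n, timeAverage (fun k => X.R n k ω) / timeAverage (fun k => X.Tad n k ω + X.Tfr n k ω)

/-- The time average advertising expenditure. -/
noncomputable def expenditure (ω : Ω) : ℝ :=
  ∑ n, timeAverage (fun k => X.p n k ω) / timeAverage (fun k => X.Tad n k ω + X.Tfr n k ω)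

/-- A feasible strategy: with probability `1` the time averages exist and the average budget
constraint holds. -/
def IsFeasible : Prop :=
  ∀ᵐ ω ∂P, X.LimitsExist ω ∧ X.expenditure ω ≤ sys.budget

/-- The decision points `t₀ < t₁ < ⋯`: the times at which some site begins a frame, in increasing
order. -/
noncomputable def decisionPoint (ω : Ω) : ℕ → ℝ
  | 0 => 0
  | d + 1 => sInf {s : ℝ | (∃ n k, s = X.start n k ω) ∧ decisionPoint ω d < s}

/-- `kₙ(t)`: the number of frames of site `n` completed up to time `t`, which is also the index of
its current frame. -/
noncomputable def frameIndex (n : Fin N) (t : ℝ) (ω : Ω) : ℕ :=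
  Set.ncard {k : ℕ | X.start n (k + 1) ω ≤ t}

/-- `δ_d = t_{d+1} - t_d`. -/
noncomputable def delta (ω : Ω) (d : ℕ) : ℝ := X.decisionPoint ω (d + 1) - X.decisionPoint ω d

/-- The effective budget consumption rate `aₙ[t_d]`. -/
noncomputable def consumptionRate (ω : Ω) (n : Fin N) (d : ℕ) : ℝ :=
  let k := X.frameIndex n (X.decisionPoint ω d) ω
  X.p n k ω / (sys.F n (X.p n k ω) (X.cfg n k ω) + X.Tfr n k ω)

/-- The virtual deficit queue `Q(t_d)`. -/
noncomputable def Q (ω : Ω) : ℕ → ℝ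
  | 0 => 0
  | d + 1 => max (Q ω d - X.delta ω d * sys.budget) 0
      + X.delta ω d * ∑ n, X.consumptionRate ω n d

/-- The strategy is Ad-Investment with parameter `V`: at each decision point `t_d`, every site that
begins a frame gets an action that maximizes `Ψₙ` at the current deficit `Q(t_d)` over all feasible
actions. -/
def IsAdInvestment (V : ℝ) : Prop :=
  ∀ᵐ ω ∂P, ∀ d n, (∃ j, X.start n j ω = X.decisionPoint ω d) →
    let k := X.frameIndex n (X.decisionPoint ω d) ω
    ∀ p T (m : Cfg n), (p, T) ∈ sys.actions n →
      sys.Psi n V (X.Q ω d) p T m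
        ≤ sys.Psi n V (X.Q ω d) (X.p n k ω) (X.Tfr n k ω) (X.cfg n k ω)

end AdProcess

namespace AdSystem

variable {N : ℕ} {Cfg : Fin N → Type u} [∀ n, MeasurableSpace (Cfg n)] (sys : AdSystem N Cfg)

/-- The (expected) time average revenues of all feasible strategies. -/
def achievableProfits : Set ℝ :=
  {x | ∃ (Ω : Type u) (_ : MeasurableSpace Ω) (P : Measure Ω) (_ : IsProbabilityMeasure P)
    (X : AdProcess sys P), X.IsFeasible ∧ x = ∫ ω, X.profit ω ∂P}

/-- `Profit*_av`, the optimal time average revenue under the average budget constraint. -/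
noncomputable def profitStar : ℝ := sSup sys.achievableProfits

end AdSystem

/-!
The proof is a drift-plus-penalty argument on a sample path, combined with weak Lagrangian duality
and a strong law of large numbers.

*Duality.* Given the information at the beginning of a frame, the revenue and the depletion time
have conditional means `Gₙ(p, m)` and `Fₙ(p, m)` (`condExp_eq_integral_of_condLaw`), so by the
strong law for bounded martingale differences (`ae_tendsto_average_martingaleDiff`) the time
averages of any strategy are those of the means. Hence, if `ψₙ` bounds the objective
`(V Gₙ - q p) / (Fₙ + T)` over all actions, the time averages at site `n` satisfy
`V R̄ - q p̄ ≤ ψₙ T̄`, and a feasible strategy has `V Profit ≤ ∑ₙ ψₙ + q B_av` for every `q ≥ 0`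
(`AdProcess.ae_profit_le`). Values obeying all these bounds are called `AdSystem.IsDualBounded`.

*Drift.* Ad-Investment makes the objective of each site maximal, at the deficit of the beginning of
the frame. The deficit changes at most at the rate `M = max r B_av`, where `r = ∑ₙ pₙᵐᵃˣ / Tₙᵐⁱⁿ`,
so the objective remains maximal at later deficits up to `M · age · pₙᵐᵃˣ / Tₙᵐⁱⁿ`, where `age` is
the age of the current frame (`RegularAt.Psi_le_current`). These values serve as `ψₙ` in the dual
bound at `q = Q(t_d)`. The staleness errors are absorbed by adding the age potentials
`age (Tᵐᵃˣ - age)` to the Lyapunov function `Q² / 2`. A step of length `δ` has a drift error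
`½ δ² (r² + B_av²)`, and the age potentials leave a staleness error `½ r M (Tᵐᵃˣ δ - δ²)`; as
`r M ≤ r² + B_av²`, the two together are at most `½ Tᵐᵃˣ δ (r² + B_av²)` (`RegularAt.drift_le`).
Summation over the steps bounds the revenue rate integrated over `[0, t_D]` from below, and by the
strong law its average converges to the time average revenue (`ae_tendsto_profit`). The resulting
gap `½ Tᵐᵃˣ (r² + B_av²) / V` is at most `C₀ / (V Tᵐⁱⁿ)`.

*Deficit.* A frame that begins while `Q > V ν` gets no investment. After the deficit has passed the
level `V ν` it therefore grows only until all frames begun before have ended, which gives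
`RegularAt.Q_le`. Since the deficit bounds the overspending and is bounded, the budget constraint
holds in the limit.
-/

/-! ### A strong law for bounded martingale differences -/

section StrongLaw

variable {Ω : Type v} {mΩ : MeasurableSpace Ω} {P : Measure Ω}

/-- Second moments of the partial sums of bounded martingale differences grow at most linearly. -/
theorem integral_sq_sum_martingaleDiff_le [IsProbabilityMeasure P] (𝒢 : Filtration ℕ mΩ)
    {X : ℕ → Ω → ℝ} {c : ℝ} (hX : ∀ k, StronglyMeasurable[𝒢 (k + 1)] (X k))
    (hb : ∀ k, ∀ᵐ ω ∂P, |X k ω| ≤ c) (h0 : ∀ k, P[X k | 𝒢 k] =ᵐ[P] 0) (K : ℕ) :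
    MemLp (fun ω => ∑ k ∈ Finset.range K, X k ω) 2 P ∧
      ∫ ω, (∑ k ∈ Finset.range K, X k ω) ^ 2 ∂P ≤ K * c ^ 2 := by
  have hmem : ∀ k, MemLp (X k) 2 P := fun k =>
    MemLp.of_bound ((hX k).mono (𝒢.le _)).aestronglyMeasurable c (hb k)
  have hS : ∀ K, MemLp (fun ω => ∑ k ∈ Finset.range K, X k ω) 2 P := fun K =>
    memLp_finsetSum _ fun k _ => hmem k
  refine ⟨hS K, ?_⟩
  induction K with
  | zero => simp
  | succ K ih =>
    have hSm : StronglyMeasurable[𝒢 K] (fun ω => ∑ k ∈ Finset.range K, X k ω) := by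
      refine Finset.stronglyMeasurable_fun_sum _ fun k hk => (hX k).mono (𝒢.mono ?_)
      have := Finset.mem_range.1 hk
      omega
    have hprod : Integrable ((fun ω => ∑ k ∈ Finset.range K, X k ω) * X K) P :=
      (hS K).integrable_mul (hmem K)
    have hcross : ∫ ω, (∑ k ∈ Finset.range K, X k ω) * X K ω ∂P = 0 := by
      have h1 := condExp_mul_of_stronglyMeasurable_left hSm hprod ((hmem K).integrable (by norm_num))
      rw [show (fun ω => (∑ k ∈ Finset.range K, X k ω) * X K ω)
        = (fun ω => ∑ k ∈ Finset.range K, X k ω) * X K from rfl, ← integral_condExp (𝒢.le K),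
        integral_congr_ae h1]
      refine integral_eq_zero_of_ae ?_
      filter_upwards [h0 K] with ω hω
      simp [hω]
    have hsq : ∫ ω, (X K ω) ^ 2 ∂P ≤ c ^ 2 := by
      have : ∫ ω, (X K ω) ^ 2 ∂P ≤ ∫ _, c ^ 2 ∂P := by
        refine integral_mono_ae (hmem K).integrable_sq (integrable_const _) ?_
        filter_upwards [hb K] with ω hω
        exact sq_le_sq' (abs_le.1 hω).1 (abs_le.1 hω).2
      simpa using this
    have hexp : ∀ ω, (∑ k ∈ Finset.range (K + 1), X k ω) ^ 2
        = (∑ k ∈ Finset.range K, X k ω) ^ 2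
          + (2 * ((∑ k ∈ Finset.range K, X k ω) * X K ω) + (X K ω) ^ 2) := by
      intro ω
      rw [Finset.sum_range_succ]
      ring
    have hprod' : Integrable (fun ω => 2 * ((∑ k ∈ Finset.range K, X k ω) * X K ω)) P :=
      hprod.const_mul 2
    simp_rw [hexp]
    have hsum : Integrable (fun ω => 2 * ((∑ k ∈ Finset.range K, X k ω) * X K ω) + (X K ω) ^ 2) P :=
      hprod'.add (hmem K).integrable_sq
    rw [integral_add (hS K).integrable_sq hsum, integral_add hprod' (hmem K).integrable_sq, integral_const_mul, hcross]
    push_cast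
    linarith

/-- Strong law of large numbers for bounded martingale differences. The second moments of the
averages are summable along the squares, and boundedness fills the gaps between squares. -/
theorem ae_tendsto_average_martingaleDiff [IsProbabilityMeasure P] (𝒢 : Filtration ℕ mΩ)
    {X : ℕ → Ω → ℝ} {c : ℝ} (hX : ∀ k, StronglyMeasurable[𝒢 (k + 1)] (X k))
    (hb : ∀ k, ∀ᵐ ω ∂P, |X k ω| ≤ c) (h0 : ∀ k, P[X k | 𝒢 k] =ᵐ[P] 0) :
    ∀ᵐ ω ∂P, Tendsto (fun K : ℕ => (1 / (K : ℝ)) * ∑ k ∈ Finset.range K, X k ω) atTop (𝓝 0) := by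
  set S : ℕ → Ω → ℝ := fun K ω => ∑ k ∈ Finset.range K, X k ω with hSdef
  have hmom := integral_sq_sum_martingaleDiff_le 𝒢 hX hb h0
  set Y : ℕ → Ω → ℝ := fun j ω => (S ((j + 1) ^ 2) ω / ((j + 1 : ℕ) : ℝ) ^ 2) ^ 2 with hY
  have hYint : ∀ j, Integrable (Y j) P := by
    intro j
    have := (hmom ((j + 1) ^ 2)).1.integrable_sq.div_const ((((j + 1 : ℕ) : ℝ) ^ 2) ^ 2)
    simpa only [hY, div_pow] using this
  have hYle : ∀ j, ∫ ω, Y j ω ∂P ≤ c ^ 2 * (1 / ((j + 1 : ℕ) : ℝ) ^ 2) := by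
    intro j
    have h := (hmom ((j + 1) ^ 2)).2
    have hpos : (0 : ℝ) < ((j + 1 : ℕ) : ℝ) := by positivity
    simp only [hY, div_pow]
    rw [integral_div, div_le_iff₀ (by positivity)]
    refine h.trans (le_of_eq ?_)
    push_cast
    field_simp
  have hsum : Summable fun j : ℕ => c ^ 2 * (1 / ((j + 1 : ℕ) : ℝ) ^ 2) :=
    (((summable_nat_add_iff 1).2 (Real.summable_one_div_nat_pow.2 one_lt_two))).mul_left _
  have hYae : ∀ᵐ ω ∂P, Tendsto (fun j => Y j ω) atTop (𝓝 0) := by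
    have hfin : ∫⁻ ω, ∑' j, ENNReal.ofReal (Y j ω) ∂P ≠ ⊤ := by
      rw [lintegral_tsum fun j => (hYint j).1.aemeasurable.ennreal_ofReal]
      refine ne_top_of_le_ne_top hsum.tsum_ofReal_ne_top (ENNReal.tsum_le_tsum fun j => ?_)
      rw [← ofReal_integral_eq_lintegral_ofReal (hYint j) (ae_of_all _ fun ω => sq_nonneg _)]
      exact ENNReal.ofReal_le_ofReal (hYle j)
    filter_upwards [ae_lt_top' (AEMeasurable.tsum
      fun j => (hYint j).1.aemeasurable.ennreal_ofReal) hfin] with ω hω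
    have h1 := ENNReal.tendsto_atTop_zero_of_tsum_ne_top hω.ne
    have h2 := (ENNReal.tendsto_toReal ENNReal.zero_ne_top).comp h1
    refine (Tendsto.congr (fun j => ?_) h2)
    simp only [Function.comp]
    exact ENNReal.toReal_ofReal (sq_nonneg _)
  filter_upwards [hYae, ae_all_iff.2 hb] with ω hω hbω
  have hc : 0 ≤ c := (abs_nonneg _).trans (hbω 0)
  have hA : Tendsto (fun j : ℕ => |S ((j + 1) ^ 2) ω / ((j + 1 : ℕ) : ℝ) ^ 2|) atTop (𝓝 0) := by
    have := hω.sqrt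
    simpa only [hY, Real.sqrt_sq_eq_abs, Real.sqrt_zero] using this
  have hA' : Tendsto (fun j : ℕ => |S (j ^ 2) ω / ((j : ℕ) : ℝ) ^ 2|) atTop (𝓝 0) :=
    (tendsto_add_atTop_iff_nat 1).1 hA
  have hB : Tendsto (fun j : ℕ => c * 2 / (j : ℝ)) atTop (𝓝 0) :=
    tendsto_const_div_atTop_nhds_zero_nat _
  have hAB := hA'.add hB
  rw [add_zero] at hAB
  have hsqrt : Tendsto Nat.sqrt atTop atTop := by
    refine tendsto_atTop.2 fun b => ?_
    filter_upwards [eventually_ge_atTop (b * b)] with K hK using Nat.le_sqrt.2 hK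
  refine squeeze_zero_norm' ?_ (hAB.comp hsqrt)
  filter_upwards [eventually_ge_atTop 1] with K hK
  set j := Nat.sqrt K with hj
  have hj1 : 1 ≤ j := Nat.le_sqrt.2 (by simpa using hK)
  have hjK : j ^ 2 ≤ K := by rw [pow_two]; exact Nat.sqrt_le K
  have hKj : K ≤ j ^ 2 + 2 * j := by
    have := Nat.sqrt_le_add K
    rw [← hj] at this
    nlinarith
  have hdiff : |S K ω - S (j ^ 2) ω| ≤ c * (2 * j) := by
    have h1 : S K ω - S (j ^ 2) ω = ∑ k ∈ Finset.Ico (j ^ 2) K, X k ω :=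
      (Finset.sum_Ico_eq_sub _ hjK).symm
    rw [h1]
    refine (Finset.abs_sum_le_sum_abs _ _).trans ((Finset.sum_le_card_nsmul _ _ c
      fun k _ => hbω k).trans ?_)
    rw [Nat.card_Ico, nsmul_eq_mul, mul_comm]
    refine mul_le_mul_of_nonneg_left ?_ hc
    have : K - j ^ 2 ≤ 2 * j := by omega
    exact_mod_cast this
  have hjpos : (0 : ℝ) < j := by exact_mod_cast hj1
  have hKpos : (0 : ℝ) < K := by exact_mod_cast hK
  have hjKr : (j : ℝ) ^ 2 ≤ K := by exact_mod_cast hjK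
  have hSK : |S K ω| ≤ |S (j ^ 2) ω| + c * (2 * j) := by
    have := abs_sub_abs_le_abs_sub (S K ω) (S (j ^ 2) ω)
    linarith
  have hgoal : ‖1 / (K : ℝ) * S K ω‖ ≤ (|S (j ^ 2) ω| + c * (2 * j)) / (j : ℝ) ^ 2 := by
    rw [norm_mul, Real.norm_eq_abs, Real.norm_eq_abs, abs_of_pos (by positivity), one_div,
      inv_mul_eq_div]
    exact (div_le_div_of_nonneg_right hSK hKpos.le).trans
      (div_le_div_of_nonneg_left (by positivity) (by positivity) hjKr)
  refine hgoal.trans (le_of_eq ?_)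
  simp only [Function.comp, ← hj]
  rw [abs_div, abs_of_pos (show (0 : ℝ) < (j : ℝ) ^ 2 by positivity)]
  field_simp

end StrongLaw

/-! ### Conditional laws -/

section CondLaw

variable {Ω : Type v} {𝒢 mΩ : MeasurableSpace Ω} {P : Measure Ω} {α β : Type*} [MeasurableSpace α]
  [MeasurableSpace β]

/-- If `κ ∘ U` is the conditional law of `Z` given `𝒢`, then on every event `A` of `𝒢` the law of
`Z` is the mixture of the laws `κ (U ω)` over `ω ∈ A`. -/
theorem map_restrict_eq_comp_of_condLaw [IsProbabilityMeasure P] (h𝒢 : 𝒢 ≤ mΩ) (κ : Kernel α β) [IsMarkovKernel κ] {U : Ω → α} (hU : Measurable U)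
    {Z : Ω → β} (hZ : Measurable Z)
    (hlaw : ∀ s : Set β, MeasurableSet s → P⟦Z ⁻¹' s | 𝒢⟧ =ᵐ[P] fun ω => (κ (U ω)).real s)
    {A : Set Ω} (hA : MeasurableSet[𝒢] A) :
    (P.restrict A).map Z = (κ.comap U hU) ∘ₘ (P.restrict A) := by
  ext s hs
  have hAm : MeasurableSet A := h𝒢 _ hA
  have hZs : MeasurableSet (Z ⁻¹' s) := hZ hs
  rw [Measure.map_apply hZ hs, Measure.bind_apply hs (Kernel.aemeasurable _),
    Measure.restrict_apply hZs]
  have hint : Integrable ((Z ⁻¹' s).indicator fun _ => (1 : ℝ)) P :=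
    (integrable_const 1).indicator hZs
  have h1 : ∫ ω in A, (κ (U ω)).real s ∂P = P.real (Z ⁻¹' s ∩ A) := by
    rw [← integral_congr_ae (ae_restrict_of_ae (hlaw s hs)), setIntegral_condExp h𝒢 hint hA,
      integral_indicator hZs, setIntegral_const, smul_eq_mul, mul_one, measureReal_restrict_apply hZs]
  have hmeas : Measurable fun ω => κ (U ω) s := (κ.measurable_coe hs).comp hU
  have h2 : ∫ ω in A, (κ (U ω)).real s ∂P = (∫⁻ ω in A, κ (U ω) s ∂P).toReal :=
    integral_toReal hmeas.aemeasurable (ae_of_all _ fun ω => measure_lt_top _ _)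
  have h3 : ∫⁻ ω in A, κ (U ω) s ∂P ≠ ⊤ := by
    refine ne_top_of_le_ne_top (measure_ne_top (P.restrict A) Set.univ) ?_
    calc ∫⁻ ω in A, κ (U ω) s ∂P ≤ ∫⁻ _ in A, 1 ∂P := lintegral_mono fun ω => prob_le_one
      _ = _ := by simp
  simp only [Kernel.comap_apply]
  rw [← ENNReal.toReal_eq_toReal_iff' (measure_ne_top _ _) h3, ← h2, h1, Measure.real]

/-- A property that holds almost surely under the conditional law at every point of an event `A` of
`𝒢` holds almost surely on `A`. -/
theorem ae_of_condLaw [IsProbabilityMeasure P] (h𝒢 : 𝒢 ≤ mΩ) (κ : Kernel α β) [IsMarkovKernel κ] {U : Ω → α} (hU : Measurable U)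
    {Z : Ω → β} (hZ : Measurable Z)
    (hlaw : ∀ s : Set β, MeasurableSet s → P⟦Z ⁻¹' s | 𝒢⟧ =ᵐ[P] fun ω => (κ (U ω)).real s)
    {A : Set Ω} (hA : MeasurableSet[𝒢] A) {q : β → Prop} (hq : MeasurableSet {z | q z})
    (h : ∀ ω ∈ A, ∀ᵐ z ∂κ (U ω), q z) : ∀ᵐ ω ∂P, ω ∈ A → q (Z ω) := by
  rw [← ae_restrict_iff' (h𝒢 _ hA)]
  refine (ae_map_iff hZ.aemeasurable hq).1 ?_
  rw [map_restrict_eq_comp_of_condLaw h𝒢 κ hU hZ hlaw hA, Measure.ae_comp_iff hq]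
  exact (ae_restrict_iff' (h𝒢 _ hA)).2 (ae_of_all _ h)

/-- The conditional expectation of a function of `Z` is its mean under the conditional law. -/
theorem condExp_eq_integral_of_condLaw [IsProbabilityMeasure P] (h𝒢 : 𝒢 ≤ mΩ) (κ : Kernel α β) [IsMarkovKernel κ] {U : Ω → α} (hU : Measurable[𝒢] U)
    {Z : Ω → β} (hZ : Measurable Z)
    (hlaw : ∀ s : Set β, MeasurableSet s → P⟦Z ⁻¹' s | 𝒢⟧ =ᵐ[P] fun ω => (κ (U ω)).real s)
    {f : β → ℝ} (hf : Measurable f) (hint : Integrable (fun ω => f (Z ω)) P) :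
    (fun ω => ∫ z, f z ∂κ (U ω)) =ᵐ[P] P[fun ω => f (Z ω) | 𝒢] := by
  have hUm : Measurable U := hU.mono h𝒢 le_rfl
  have hsm : StronglyMeasurable[𝒢] fun ω => ∫ z, f z ∂κ (U ω) :=
    (hf.stronglyMeasurable.integral_kernel (κ := κ)).comp_measurable hU
  have key : ∀ A : Set Ω, MeasurableSet[𝒢] A →
      IntegrableOn (fun ω => ∫ z, f z ∂κ (U ω)) A P ∧
        ∫ ω in A, ∫ z, f z ∂κ (U ω) ∂P = ∫ ω in A, f (Z ω) ∂P := by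
    intro A hA
    have hmap := map_restrict_eq_comp_of_condLaw h𝒢 κ hUm hZ hlaw hA
    rw [← Measure.snd_compProd, Measure.snd] at hmap
    have hi : Integrable f ((P.restrict A).map Z) :=
      (integrable_map_measure hf.aestronglyMeasurable hZ.aemeasurable).2 hint.integrableOn
    have hi' : Integrable (fun x : Ω × β => f x.2) ((P.restrict A) ⊗ₘ (κ.comap U hUm)) := by
      rw [hmap] at hi
      exact (integrable_map_measure hf.aestronglyMeasurable measurable_snd.aemeasurable).1 hi
    refine ⟨MeasureTheory.Integrable.integral_compProd (κ := Kernel.const Unit (P.restrict A))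
      (a := ()) hi', ?_⟩
    have h1 : ∫ ω in A, f (Z ω) ∂P = ∫ z, f z ∂((P.restrict A).map Z) :=
      (integral_map hZ.aemeasurable hf.aestronglyMeasurable).symm
    rw [h1, hmap, integral_map measurable_snd.aemeasurable hf.aestronglyMeasurable,
      Measure.integral_compProd hi']
    rfl
  exact ae_eq_condExp_of_forall_setIntegral_eq h𝒢 hint (fun A hA _ => (key A hA).1)
    (fun A hA _ => (key A hA).2) hsm.aestronglyMeasurable

end CondLaw

/-! ### Bounds on the means of a frame -/

namespace AdSystem

variable {N : ℕ} {Cfg : Fin N → Type u} [∀ n, MeasurableSpace (Cfg n)] (sys : AdSystem N Cfg)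

theorem integrable_fst {n : Fin N} {p T : ℝ} (m : Cfg n) (h : (p, T) ∈ sys.actions n) :
    Integrable (fun z : ℝ × ℝ => z.1) (sys.law n (p, m)) := by
  have := sys.law_markov n
  refine Integrable.of_bound measurable_fst.aestronglyMeasurable (sys.frameMax n - T) ?_
  filter_upwards [sys.frame_bounds n p T m h] with z hz
  rw [Real.norm_eq_abs, abs_of_nonneg hz.1]
  linarith

theorem frameMin_le_F_add {n : Fin N} {p T : ℝ} (m : Cfg n) (h : (p, T) ∈ sys.actions n) :
    sys.frameMin n ≤ sys.F n p m + T := by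
  have := sys.law_markov n
  have h1 : ∫ _, (sys.frameMin n - T) ∂(sys.law n (p, m)) ≤ sys.F n p m := by
    refine integral_mono_ae (integrable_const _) (sys.integrable_fst m h) ?_
    filter_upwards [sys.frame_bounds n p T m h] with z hz
    linarith
  simp at h1
  linarith

theorem F_add_le_frameMax {n : Fin N} {p T : ℝ} (m : Cfg n) (h : (p, T) ∈ sys.actions n) :
    sys.F n p m + T ≤ sys.frameMax n := by
  have := sys.law_markov n
  have h1 : sys.F n p m ≤ ∫ _, (sys.frameMax n - T) ∂(sys.law n (p, m)) := by
    refine integral_mono_ae (sys.integrable_fst m h) (integrable_const _) ?_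
    filter_upwards [sys.frame_bounds n p T m h] with z hz
    linarith
  simp at h1
  linarith

theorem F_nonneg {n : Fin N} {p T : ℝ} (m : Cfg n) (h : (p, T) ∈ sys.actions n) :
    0 ≤ sys.F n p m :=
  integral_nonneg_of_ae ((sys.frame_bounds n p T m h).mono fun _ hz => hz.1)

theorem F_add_pos {n : Fin N} {p T : ℝ} (m : Cfg n) (h : (p, T) ∈ sys.actions n) :
    0 < sys.F n p m + T :=
  (sys.frameMin_pos n).trans_le (sys.frameMin_le_F_add m h)

theorem abs_G_le {n : Fin N} {p T : ℝ} (m : Cfg n) (h : (p, T) ∈ sys.actions n) :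
    |sys.G n p m| ≤ sys.revMax n := by
  have := sys.law_markov n
  have := norm_integral_le_of_norm_le_const (f := fun z : ℝ × ℝ => z.2)
    (sys.revenue_bound n p T m h)
  simpa [G] using this

theorem rate_nonneg {n : Fin N} {p T : ℝ} (m : Cfg n) (h : (p, T) ∈ sys.actions n) :
    0 ≤ p / (sys.F n p m + T) :=
  div_nonneg (sys.invest_bounds n p T h).1 (sys.F_add_pos m h).le

theorem rate_le {n : Fin N} {p T : ℝ} (m : Cfg n) (h : (p, T) ∈ sys.actions n) :
    p / (sys.F n p m + T) ≤ sys.pMax n / sys.frameMin n :=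
  div_le_div₀ ((sys.invest_bounds n p T h).1.trans (sys.invest_bounds n p T h).2)
    (sys.invest_bounds n p T h).2 (sys.frameMin_pos n) (sys.frameMin_le_F_add m h)

theorem pMax_nonneg (n : Fin N) : 0 ≤ sys.pMax n := by
  obtain ⟨T, hT⟩ := sys.zero_option n
  exact (sys.invest_bounds n 0 T hT).2

theorem pMax_div_nonneg (n : Fin N) : 0 ≤ sys.pMax n / sys.frameMin n :=
  div_nonneg (sys.pMax_nonneg n) (sys.frameMin_pos n).le

theorem maxRate_nonneg : 0 ≤ sys.maxRate :=
  Finset.sum_nonneg fun n _ => sys.pMax_div_nonneg n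

/-- Not investing makes the objective vanish. -/
theorem exists_Psi_eq_zero (n : Fin N) (V q : ℝ) (m : Cfg n) :
    ∃ T, ((0 : ℝ), T) ∈ sys.actions n ∧ sys.Psi n V q 0 T m = 0 := by
  obtain ⟨T, hT⟩ := sys.zero_option n
  refine ⟨T, hT, ?_⟩
  have h := sys.mean_revenue n 0 T m hT
  have hG : sys.G n 0 m = 0 := le_antisymm (by simpa [G] using h.2) h.1
  simp [Psi, hG]

theorem frameMax_le_Tmax [NeZero N] (n : Fin N) : sys.frameMax n ≤ sys.Tmax :=
  Finset.le_sup' sys.frameMax (Finset.mem_univ n)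

theorem Tmin_pos [NeZero N] : 0 < sys.Tmin := by
  simp only [Tmin, Finset.lt_inf'_iff]
  exact fun n _ => sys.frameMin_pos n

end AdSystem

/-! ### Frames of a strategy: information, outcomes and averages -/

namespace AdProcess

variable {N : ℕ} {Cfg : Fin N → Type u} [∀ n, MeasurableSpace (Cfg n)] {sys : AdSystem N Cfg}
  {Ω : Type v} [mΩ : MeasurableSpace Ω] {P : Measure Ω} (X : AdProcess sys P)

theorem start_zero (n : Fin N) (ω : Ω) : X.start n 0 ω = 0 := by
  simp [start, frameStart]

theorem start_succ (n : Fin N) (k : ℕ) (ω : Ω) :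
    X.start n (k + 1) ω = X.start n k ω + (X.Tad n k ω + X.Tfr n k ω) := by
  simp [start, frameStart, Finset.sum_range_succ]

theorem start_mono (n : Fin N) (ω : Ω) : Monotone fun k => X.start n k ω := by
  refine monotone_nat_of_le_succ fun k => ?_
  rw [start_succ]
  linarith [X.Tad_nonneg n k ω, sys.freeze_nonneg n _ _ (X.feasible n k ω)]

/-- The information available at the beginnings of the successive frames of site `n`. -/
noncomputable def frameInfo (n : Fin N) : Filtration ℕ mΩ where
  seq k := (X.isStoppingTime_start n k).measurableSpace
  mono' _ _ hkl := IsStoppingTime.measurableSpace_mono _ _ fun ω =>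
    WithTop.coe_le_coe.2 (X.start_mono n ω hkl)
  le' _ := IsStoppingTime.measurableSpace_le _

theorem measurable_start (n : Fin N) (k : ℕ) : Measurable[X.frameInfo n k] (X.start n k) :=
  (WithTop.measurable_untopD (0 : ℝ)).comp (X.isStoppingTime_start n k).measurable

/-- The depletion time of a frame is known at the end of the frame. -/
theorem measurable_Tad (n : Fin N) (k : ℕ) : Measurable[X.frameInfo n (k + 1)] (X.Tad n k) := by
  have hle := (X.frameInfo n).mono (Nat.le_succ k)
  have h : X.Tad n k = fun ω => X.start n (k + 1) ω - X.start n k ω - X.Tfr n k ω := by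
    funext ω
    rw [start_succ]
    ring
  rw [h]
  exact ((X.measurable_start n (k + 1)).sub ((X.measurable_start n k).mono hle le_rfl)).sub
    ((X.measurable_Tfr n k).mono hle le_rfl)

theorem measurable_action (n : Fin N) (k : ℕ) :
    Measurable[X.frameInfo n k] fun ω => (X.p n k ω, X.cfg n k ω) :=
  (X.measurable_p n k).prodMk (X.measurable_cfg n k)

theorem measurable_outcome (n : Fin N) (k : ℕ) :
    Measurable fun ω => (X.Tad n k ω, X.R n k ω) :=
  ((X.measurable_Tad n k).mono ((X.frameInfo n).le _) le_rfl).prodMk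
    ((X.measurable_R n k).mono ((X.frameInfo n).le (k + 1)) le_rfl)

/-- A property of the outcome of a frame holds almost surely on an event `A` known at the beginning
of the frame, if it holds almost surely under the law of the chosen action on `A`. -/
theorem ae_outcome [IsProbabilityMeasure P] (n : Fin N) (k : ℕ) {A : Set Ω}
    (hA : MeasurableSet[X.frameInfo n k] A) {q : ℝ × ℝ → Prop} (hq : MeasurableSet {z | q z})
    (h : ∀ ω ∈ A, ∀ᵐ z ∂(sys.law n (X.p n k ω, X.cfg n k ω)), q z) :
    ∀ᵐ ω ∂P, ω ∈ A → q (X.Tad n k ω, X.R n k ω) := by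
  have := sys.law_markov n
  exact ae_of_condLaw ((X.frameInfo n).le k) (sys.law n)
    ((X.measurable_action n k).mono ((X.frameInfo n).le k) le_rfl) (X.measurable_outcome n k)
    (X.outcome_law n k) hA hq h

theorem ae_revenue_bound [IsProbabilityMeasure P] (n : Fin N) (k : ℕ) :
    ∀ᵐ ω ∂P, |X.R n k ω| ≤ sys.revMax n := by
  have := X.ae_outcome n k (A := Set.univ) MeasurableSet.univ
    (q := fun z => |z.2| ≤ sys.revMax n)
    (measurableSet_le (by fun_prop) measurable_const)
    fun ω _ => sys.revenue_bound n _ _ _ (X.feasible n k ω)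
  simpa using this

/-- Frame lengths are almost surely within their bounds. The freeze time is random, so the events
are split at rational levels of the depletion time. -/
theorem ae_frame_bounds [IsProbabilityMeasure P] (n : Fin N) (k : ℕ) :
    ∀ᵐ ω ∂P, sys.frameMin n ≤ X.Tad n k ω + X.Tfr n k ω ∧
      X.Tad n k ω + X.Tfr n k ω ≤ sys.frameMax n := by
  have hlow : ∀ q : ℚ, ∀ᵐ ω ∂P, X.Tfr n k ω ≤ sys.frameMin n - q → (q : ℝ) ≤ X.Tad n k ω := by
    intro q
    refine X.ae_outcome n k (A := {ω | X.Tfr n k ω ≤ sys.frameMin n - q})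
      (q := fun z => (q : ℝ) ≤ z.1) (measurableSet_le (X.measurable_Tfr n k) measurable_const)
      (measurableSet_le measurable_const measurable_fst) fun ω hω => ?_
    filter_upwards [sys.frame_bounds n _ _ (X.cfg n k ω) (X.feasible n k ω)] with z hz
    have : X.Tfr n k ω ≤ sys.frameMin n - q := hω
    linarith
  have hupp : ∀ q : ℚ, ∀ᵐ ω ∂P, sys.frameMax n - q ≤ X.Tfr n k ω → X.Tad n k ω ≤ (q : ℝ) := by
    intro q
    refine X.ae_outcome n k (A := {ω | sys.frameMax n - q ≤ X.Tfr n k ω})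
      (q := fun z => z.1 ≤ (q : ℝ)) (measurableSet_le measurable_const (X.measurable_Tfr n k))
      (measurableSet_le measurable_fst measurable_const) fun ω hω => ?_
    filter_upwards [sys.frame_bounds n _ _ (X.cfg n k ω) (X.feasible n k ω)] with z hz
    have : sys.frameMax n - q ≤ X.Tfr n k ω := hω
    linarith
  filter_upwards [ae_all_iff.2 hlow, ae_all_iff.2 hupp] with ω h1 h2
  constructor
  · by_contra! hlt
    obtain ⟨q, hq1, hq2⟩ := exists_rat_btwn (show X.Tad n k ω < sys.frameMin n - X.Tfr n k ω by
      linarith)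
    exact absurd (h1 q (by linarith)) (by linarith)
  · by_contra! hlt
    obtain ⟨q, hq1, hq2⟩ := exists_rat_btwn (show sys.frameMax n - X.Tfr n k ω < X.Tad n k ω by
      linarith)
    exact absurd (h2 q (by linarith)) (by linarith)

/-- The mean depletion time of frame `k` of site `n` under the chosen action. -/
noncomputable def meanTad (n : Fin N) (k : ℕ) (ω : Ω) : ℝ := sys.F n (X.p n k ω) (X.cfg n k ω)

/-- The mean revenue of frame `k` of site `n` under the chosen action. -/
noncomputable def meanRev (n : Fin N) (k : ℕ) (ω : Ω) : ℝ := sys.G n (X.p n k ω) (X.cfg n k ω)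

theorem measurable_meanTad (n : Fin N) (k : ℕ) : Measurable[X.frameInfo n k] (X.meanTad n k) :=
  (measurable_fst.stronglyMeasurable.integral_kernel (κ := sys.law n)).measurable.comp
    (X.measurable_action n k)

theorem measurable_meanRev (n : Fin N) (k : ℕ) : Measurable[X.frameInfo n k] (X.meanRev n k) :=
  (measurable_snd.stronglyMeasurable.integral_kernel (κ := sys.law n)).measurable.comp
    (X.measurable_action n k)

theorem integrable_Tad [IsProbabilityMeasure P] (n : Fin N) (k : ℕ) : Integrable (X.Tad n k) P := by
  refine Integrable.of_bound (measurable_fst.comp (X.measurable_outcome n k)).aestronglyMeasurable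
    (sys.frameMax n) ?_
  filter_upwards [X.ae_frame_bounds n k] with ω hω
  rw [Real.norm_eq_abs, abs_of_nonneg (X.Tad_nonneg n k ω)]
  linarith [sys.freeze_nonneg n _ _ (X.feasible n k ω)]

theorem integrable_R [IsProbabilityMeasure P] (n : Fin N) (k : ℕ) : Integrable (X.R n k) P :=
  Integrable.of_bound (measurable_snd.comp (X.measurable_outcome n k)).aestronglyMeasurable
    (sys.revMax n) (X.ae_revenue_bound n k)

theorem condExp_Tad [IsProbabilityMeasure P] (n : Fin N) (k : ℕ) :
    P[X.Tad n k | X.frameInfo n k] =ᵐ[P] X.meanTad n k := by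
  have := sys.law_markov n
  exact (condExp_eq_integral_of_condLaw ((X.frameInfo n).le k) (sys.law n)
    (X.measurable_action n k) (X.measurable_outcome n k) (X.outcome_law n k) measurable_fst
    (X.integrable_Tad n k)).symm

theorem condExp_R [IsProbabilityMeasure P] (n : Fin N) (k : ℕ) :
    P[X.R n k | X.frameInfo n k] =ᵐ[P] X.meanRev n k := by
  have := sys.law_markov n
  exact (condExp_eq_integral_of_condLaw ((X.frameInfo n).le k) (sys.law n)
    (X.measurable_action n k) (X.measurable_outcome n k) (X.outcome_law n k) measurable_snd
    (X.integrable_R n k)).symm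

/-- Revenues average out to the mean revenues of the chosen actions. -/
theorem ae_tendsto_average_R_sub [IsProbabilityMeasure P] (n : Fin N) :
    ∀ᵐ ω ∂P, Tendsto (fun K : ℕ => (1 / (K : ℝ)) * ∑ k ∈ Finset.range K,
      (X.R n k ω - X.meanRev n k ω)) atTop (𝓝 0) := by
  refine ae_tendsto_average_martingaleDiff (X.frameInfo n) (c := sys.revMax n + sys.revMax n)
    (X := fun k ω => X.R n k ω - X.meanRev n k ω) (fun k => ?_) (fun k => ?_) fun k => ?_
  · exact ((X.measurable_R n k).sub ((X.measurable_meanRev n k).mono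
      ((X.frameInfo n).mono k.le_succ) le_rfl)).stronglyMeasurable
  · filter_upwards [X.ae_revenue_bound n k] with ω hω
    exact (abs_sub _ _).trans (add_le_add hω (sys.abs_G_le _ (X.feasible n k ω)))
  · have hG : Integrable (X.meanRev n k) P :=
      integrable_condExp.congr (X.condExp_R n k)
    have h1 := condExp_sub (X.integrable_R n k) hG (X.frameInfo n k)
    have h2 := condExp_of_stronglyMeasurable ((X.frameInfo n).le k)
      (X.measurable_meanRev n k).stronglyMeasurable hG
    rw [h2] at h1
    filter_upwards [h1, X.condExp_R n k] with ω h3 h4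
    refine h3.trans ?_
    simp [h4]

/-- Depletion times average out to their means, also after multiplication by bounded weights that
are known at the beginning of each frame. -/
theorem ae_tendsto_average_mul_Tad_sub [IsProbabilityMeasure P] (n : Fin N) {w : ℕ → Ω → ℝ} {c : ℝ}
    (hw : ∀ k, Measurable[X.frameInfo n k] (w k)) (hc : ∀ k ω, |w k ω| ≤ c) :
    ∀ᵐ ω ∂P, Tendsto (fun K : ℕ => (1 / (K : ℝ)) * ∑ k ∈ Finset.range K,
      w k ω * (X.Tad n k ω - X.meanTad n k ω)) atTop (𝓝 0) := by
  have hF : ∀ k, Integrable (X.meanTad n k) P := fun k =>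
    integrable_condExp.congr (X.condExp_Tad n k)
  refine ae_tendsto_average_martingaleDiff (X.frameInfo n) (c := c * sys.frameMax n)
    (X := fun k ω => w k ω * (X.Tad n k ω - X.meanTad n k ω)) (fun k => ?_) (fun k => ?_)
    fun k => ?_
  · have hle := (X.frameInfo n).mono k.le_succ
    exact (((hw k).mono hle le_rfl).mul ((X.measurable_Tad n k).sub
      ((X.measurable_meanTad n k).mono hle le_rfl))).stronglyMeasurable
  · filter_upwards [X.ae_frame_bounds n k] with ω hω
    have hf := X.feasible n k ω
    have hT := sys.freeze_nonneg n _ _ hf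
    have h1 := sys.F_nonneg (X.cfg n k ω) hf
    have h2 := sys.F_add_le_frameMax (X.cfg n k ω) hf
    have h3 := X.Tad_nonneg n k ω
    rw [abs_mul]
    refine mul_le_mul (hc k ω) ?_ (abs_nonneg _) ((abs_nonneg _).trans (hc k ω))
    rw [abs_le]
    constructor <;> simp only [meanTad] <;> linarith
  · have hD : Integrable (X.Tad n k - X.meanTad n k) P := (X.integrable_Tad n k).sub (hF k)
    have h0 := condExp_stronglyMeasurable_mul_of_bound ((X.frameInfo n).le k)
      (hw k).stronglyMeasurable hD c (ae_of_all _ fun ω => hc k ω)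
    have h1 := condExp_sub (X.integrable_Tad n k) (hF k) (X.frameInfo n k)
    have h2 := condExp_of_stronglyMeasurable ((X.frameInfo n).le k)
      (X.measurable_meanTad n k).stronglyMeasurable (hF k)
    rw [h2] at h1
    filter_upwards [h0, h1, X.condExp_Tad n k] with ω h3 h4 h5
    refine h3.trans ?_
    simp [h4, h5]

/-- The rate of mean revenue per mean frame length during frame `k` of site `n`. -/
noncomputable def revRate (n : Fin N) (k : ℕ) (ω : Ω) : ℝ :=
  X.meanRev n k ω / (X.meanTad n k ω + X.Tfr n k ω)

/-- The rate of investment per mean frame length during frame `k` of site `n`. -/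
noncomputable def spendRate (n : Fin N) (k : ℕ) (ω : Ω) : ℝ :=
  X.p n k ω / (X.meanTad n k ω + X.Tfr n k ω)

theorem measurable_meanFrame (n : Fin N) (k : ℕ) :
    Measurable[X.frameInfo n k] fun ω => X.meanTad n k ω + X.Tfr n k ω :=
  (X.measurable_meanTad n k).add (X.measurable_Tfr n k)

theorem meanFrame_pos (n : Fin N) (k : ℕ) (ω : Ω) : 0 < X.meanTad n k ω + X.Tfr n k ω :=
  sys.F_add_pos _ (X.feasible n k ω)

theorem spendRate_nonneg (n : Fin N) (k : ℕ) (ω : Ω) : 0 ≤ X.spendRate n k ω :=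
  sys.rate_nonneg _ (X.feasible n k ω)

theorem spendRate_le (n : Fin N) (k : ℕ) (ω : Ω) :
    X.spendRate n k ω ≤ sys.pMax n / sys.frameMin n :=
  sys.rate_le _ (X.feasible n k ω)

theorem revRate_nonneg (n : Fin N) (k : ℕ) (ω : Ω) : 0 ≤ X.revRate n k ω :=
  div_nonneg (sys.mean_revenue n _ _ _ (X.feasible n k ω)).1 (X.meanFrame_pos n k ω).le

theorem revRate_le_nu_mul (n : Fin N) (k : ℕ) (ω : Ω) :
    X.revRate n k ω ≤ sys.nu * X.spendRate n k ω := by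
  rw [revRate, spendRate, ← mul_div_assoc]
  exact div_le_div_of_nonneg_right (sys.mean_revenue n _ _ _ (X.feasible n k ω)).2
    (X.meanFrame_pos n k ω).le

theorem revRate_le (n : Fin N) (k : ℕ) (ω : Ω) :
    X.revRate n k ω ≤ sys.nu * (sys.pMax n / sys.frameMin n) :=
  (X.revRate_le_nu_mul n k ω).trans (mul_le_mul_of_nonneg_left (X.spendRate_le n k ω) sys.nu_nonneg)

/-- Accruing revenue at the rate `revRate` gives the same time average as the actual revenues. -/
theorem ae_tendsto_average_revRate [IsProbabilityMeasure P] (n : Fin N) :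
    ∀ᵐ ω ∂P, Tendsto (fun K : ℕ => (1 / (K : ℝ)) * ∑ k ∈ Finset.range K,
      (X.revRate n k ω * (X.Tad n k ω + X.Tfr n k ω) - X.R n k ω)) atTop (𝓝 0) := by
  have h1 := X.ae_tendsto_average_mul_Tad_sub n (w := X.revRate n)
    (c := sys.nu * (sys.pMax n / sys.frameMin n))
    (fun k => (X.measurable_meanRev n k).div (X.measurable_meanFrame n k))
    (fun k ω => by rw [abs_of_nonneg (X.revRate_nonneg n k ω)]; exact X.revRate_le n k ω)
  filter_upwards [h1, X.ae_tendsto_average_R_sub n] with ω h2 h3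
  have h4 := h2.sub h3
  rw [sub_zero] at h4
  refine h4.congr fun K => ?_
  rw [← mul_sub, ← Finset.sum_sub_distrib]
  congr 1
  refine Finset.sum_congr rfl fun k _ => ?_
  have h5 : X.revRate n k ω * (X.meanTad n k ω + X.Tfr n k ω) = X.meanRev n k ω :=
    div_mul_cancel₀ _ (X.meanFrame_pos n k ω).ne'
  linear_combination -h5

/-- Spending at the rate `spendRate` gives the same time average as the actual investments. -/
theorem ae_tendsto_average_spendRate [IsProbabilityMeasure P] (n : Fin N) :
    ∀ᵐ ω ∂P, Tendsto (fun K : ℕ => (1 / (K : ℝ)) * ∑ k ∈ Finset.range K,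
      (X.spendRate n k ω * (X.Tad n k ω + X.Tfr n k ω) - X.p n k ω)) atTop (𝓝 0) := by
  have h1 := X.ae_tendsto_average_mul_Tad_sub n (w := X.spendRate n)
    (c := sys.pMax n / sys.frameMin n)
    (fun k => (X.measurable_p n k).div (X.measurable_meanFrame n k))
    (fun k ω => by rw [abs_of_nonneg (X.spendRate_nonneg n k ω)]; exact X.spendRate_le n k ω)
  filter_upwards [h1] with ω h2
  refine h2.congr fun K => ?_
  congr 1
  refine Finset.sum_congr rfl fun k _ => ?_
  have h5 : X.spendRate n k ω * (X.meanTad n k ω + X.Tfr n k ω) = X.p n k ω :=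
    div_mul_cancel₀ _ (X.meanFrame_pos n k ω).ne'
  linear_combination -h5

end AdProcess

/-! ### Decision points on a regular sample path -/

namespace AdProcess

variable {N : ℕ} {Cfg : Fin N → Type u} [∀ n, MeasurableSpace (Cfg n)] {sys : AdSystem N Cfg}
  {Ω : Type v} [mΩ : MeasurableSpace Ω] {P : Measure Ω} (X : AdProcess sys P) {ω : Ω}

/-- All frame lengths on the sample path `ω` are within their almost sure bounds. -/
def RegularAt (ω : Ω) : Prop :=
  ∀ n k, sys.frameMin n ≤ X.Tad n k ω + X.Tfr n k ω ∧ X.Tad n k ω + X.Tfr n k ω ≤ sys.frameMax n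

theorem ae_regularAt [IsProbabilityMeasure P] : ∀ᵐ ω ∂P, X.RegularAt ω :=
  ae_all_iff.2 fun n => ae_all_iff.2 fun k => X.ae_frame_bounds n k

/-- The frame of site `n` that is current at the decision point `t_d`. -/
noncomputable def current (ω : Ω) (n : Fin N) (d : ℕ) : ℕ :=
  X.frameIndex n (X.decisionPoint ω d) ω

/-- The age at `t_d` of the current frame of site `n`. -/
noncomputable def age (ω : Ω) (n : Fin N) (d : ℕ) : ℝ :=
  X.decisionPoint ω d - X.start n (X.current ω n d) ω

namespace RegularAt

variable {X}

theorem start_lt_succ (h : X.RegularAt ω) (n : Fin N) (k : ℕ) :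
    X.start n k ω < X.start n (k + 1) ω := by
  rw [start_succ]
  linarith [(h n k).1, sys.frameMin_pos n]

theorem start_strictMono (h : X.RegularAt ω) (n : Fin N) : StrictMono fun k => X.start n k ω :=
  strictMono_nat_of_lt_succ fun k => h.start_lt_succ n k

theorem mul_frameMin_le_start (h : X.RegularAt ω) (n : Fin N) (k : ℕ) :
    k * sys.frameMin n ≤ X.start n k ω := by
  induction k with
  | zero => simp [start_zero]
  | succ k ih =>
    rw [start_succ]
    push_cast
    linarith [(h n k).1]

theorem start_le_mul_frameMax (h : X.RegularAt ω) (n : Fin N) (k : ℕ) :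
    X.start n k ω ≤ k * sys.frameMax n := by
  induction k with
  | zero => simp [start_zero]
  | succ k ih =>
    rw [start_succ]
    push_cast
    linarith [(h n k).2]

theorem frameMax_pos (h : X.RegularAt ω) (n : Fin N) : 0 < sys.frameMax n :=
  (sys.frameMin_pos n).trans_le ((h n 0).1.trans (h n 0).2)

theorem tendsto_start (h : X.RegularAt ω) (n : Fin N) :
    Tendsto (fun k => X.start n k ω) atTop atTop :=
  tendsto_atTop_mono (h.mul_frameMin_le_start n)
    (tendsto_natCast_atTop_atTop.atTop_mul_const (sys.frameMin_pos n))

theorem exists_frame (h : X.RegularAt ω) (n : Fin N) {t : ℝ} (ht : 0 ≤ t) :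
    ∃ k, X.start n k ω ≤ t ∧ t < X.start n (k + 1) ω := by
  classical
  have hex : ∃ k, t < X.start n k ω := ((h.tendsto_start n).eventually_gt_atTop t).exists
  have hpos : Nat.find hex ≠ 0 := by
    intro h0
    have := Nat.find_spec hex
    rw [h0, start_zero] at this
    linarith
  obtain ⟨k, hk⟩ := Nat.exists_eq_succ_of_ne_zero hpos
  refine ⟨k, not_lt.1 (Nat.find_min hex (by omega)), ?_⟩
  have := Nat.find_spec hex
  rwa [hk] at this

/-- The frame index counts the frames completed, so it is the index of the frame containing `t`. -/
theorem frameIndex_eq (h : X.RegularAt ω) {n : Fin N} {t : ℝ} {k : ℕ}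
    (h1 : X.start n k ω ≤ t) (h2 : t < X.start n (k + 1) ω) : X.frameIndex n t ω = k := by
  have : {j : ℕ | X.start n (j + 1) ω ≤ t} = Set.Iio k := by
    ext j
    simp only [Set.mem_ofPred_eq, Set.mem_Iio]
    constructor
    · intro hj
      have := (h.start_strictMono n).lt_iff_lt.1 (hj.trans_lt h2)
      omega
    · intro hj
      exact (X.start_mono n ω (show j + 1 ≤ k from hj)).trans h1
  rw [frameIndex, this, ← Finset.coe_Iio, Set.ncard_coe_finset, Nat.card_Iio]

theorem current_zero (h : X.RegularAt ω) (n : Fin N) : X.current ω n 0 = 0 := by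
  refine h.frameIndex_eq ?_ ?_
  · simp [decisionPoint, start_zero]
  · have := h.start_lt_succ n 0
    rw [start_zero] at this
    simpa [decisionPoint] using this

theorem age_zero (h : X.RegularAt ω) (n : Fin N) : X.age ω n 0 = 0 := by
  simp [age, h.current_zero, decisionPoint, start_zero]

variable [NeZero N]

/-- The set of start times after `t` has a least element. -/
theorem exists_isLeast_start (h : X.RegularAt ω) {t : ℝ} (ht : 0 ≤ t) :
    ∃ s, IsLeast {s : ℝ | (∃ n k, s = X.start n k ω) ∧ t < s} s := by
  choose K hK1 hK2 using fun n => h.exists_frame n ht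
  -- every start after `t` comes no earlier than the next start of the same site
  obtain ⟨n, -, hn⟩ := Finset.exists_min_image Finset.univ (fun n => X.start n (K n + 1) ω)
    Finset.univ_nonempty
  refine ⟨X.start n (K n + 1) ω, ⟨⟨n, K n + 1, rfl⟩, hK2 n⟩, ?_⟩
  rintro s ⟨⟨m, k, rfl⟩, hs⟩
  have hk : K m + 1 ≤ k := (h.start_strictMono m).lt_iff_lt.1 ((hK1 m).trans_lt hs)
  exact (hn m (Finset.mem_univ m)).trans (X.start_mono m ω hk)

theorem decisionPoint_nonneg_and_isLeast (h : X.RegularAt ω) (d : ℕ) :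
    0 ≤ X.decisionPoint ω d ∧
      IsLeast {s : ℝ | (∃ n k, s = X.start n k ω) ∧ X.decisionPoint ω d < s}
        (X.decisionPoint ω (d + 1)) := by
  have key : ∀ d, 0 ≤ X.decisionPoint ω d →
      IsLeast {s : ℝ | (∃ n k, s = X.start n k ω) ∧ X.decisionPoint ω d < s}
        (X.decisionPoint ω (d + 1)) := by
    intro d hd
    obtain ⟨s, hs⟩ := h.exists_isLeast_start hd
    have : X.decisionPoint ω (d + 1) = s := hs.csInf_eq
    rwa [this]
  have h0 : 0 ≤ X.decisionPoint ω d := by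
    induction d with
    | zero => simp [decisionPoint]
    | succ d ih => exact ih.trans (key d ih).1.2.le
  exact ⟨h0, key d h0⟩

theorem decisionPoint_nonneg (h : X.RegularAt ω) (d : ℕ) : 0 ≤ X.decisionPoint ω d :=
  (h.decisionPoint_nonneg_and_isLeast d).1

theorem delta_pos (h : X.RegularAt ω) (d : ℕ) : 0 < X.delta ω d :=
  sub_pos.2 (h.decisionPoint_nonneg_and_isLeast d).2.1.2

theorem decisionPoint_strictMono (h : X.RegularAt ω) : StrictMono (X.decisionPoint ω) :=
  strictMono_nat_of_lt_succ fun d => sub_pos.1 (h.delta_pos d)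

theorem start_current_le (h : X.RegularAt ω) (n : Fin N) (d : ℕ) :
    X.start n (X.current ω n d) ω ≤ X.decisionPoint ω d := by
  obtain ⟨k, h1, h2⟩ := h.exists_frame n (h.decisionPoint_nonneg d)
  rw [current, h.frameIndex_eq h1 h2]
  exact h1

theorem lt_start_current_succ (h : X.RegularAt ω) (n : Fin N) (d : ℕ) :
    X.decisionPoint ω d < X.start n (X.current ω n d + 1) ω := by
  obtain ⟨k, h1, h2⟩ := h.exists_frame n (h.decisionPoint_nonneg d)
  rw [current, h.frameIndex_eq h1 h2]
  exact h2

theorem decisionPoint_succ_le (h : X.RegularAt ω) (n : Fin N) (d : ℕ) :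
    X.decisionPoint ω (d + 1) ≤ X.start n (X.current ω n d + 1) ω :=
  (h.decisionPoint_nonneg_and_isLeast d).2.2 ⟨⟨n, _, rfl⟩, h.lt_start_current_succ n d⟩

/-- Between consecutive decision points a site continues its frame, or ends it exactly at the
second one. -/
theorem current_succ (h : X.RegularAt ω) (n : Fin N) (d : ℕ) :
    (X.decisionPoint ω (d + 1) < X.start n (X.current ω n d + 1) ω ∧
      X.current ω n (d + 1) = X.current ω n d) ∨
    (X.decisionPoint ω (d + 1) = X.start n (X.current ω n d + 1) ω ∧
      X.current ω n (d + 1) = X.current ω n d + 1) := by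
  rcases (h.decisionPoint_succ_le n d).lt_or_eq with hlt | heq
  · refine Or.inl ⟨hlt, h.frameIndex_eq ?_ hlt⟩
    exact (h.start_current_le n d).trans (sub_pos.1 (h.delta_pos d)).le
  · refine Or.inr ⟨heq, h.frameIndex_eq heq.ge ?_⟩
    rw [heq]
    exact h.start_lt_succ n _

/-- The current frame of a site began at some earlier decision point. -/
theorem exists_start_current (h : X.RegularAt ω) (n : Fin N) (d : ℕ) :
    ∃ e ≤ d, X.decisionPoint ω e = X.start n (X.current ω n d) ω ∧
      X.current ω n e = X.current ω n d := by
  induction d with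
  | zero => exact ⟨0, le_rfl, by simp [h.current_zero, decisionPoint, start_zero], rfl⟩
  | succ d ih =>
    rcases h.current_succ n d with ⟨-, hc⟩ | ⟨ht, hc⟩
    · rw [hc]
      obtain ⟨e, he, h1, h2⟩ := ih
      exact ⟨e, by omega, h1, h2⟩
    · exact ⟨d + 1, le_rfl, by rw [hc, ht], rfl⟩

theorem age_nonneg (h : X.RegularAt ω) (n : Fin N) (d : ℕ) : 0 ≤ X.age ω n d :=
  sub_nonneg.2 (h.start_current_le n d)

theorem age_add_delta_le (h : X.RegularAt ω) (n : Fin N) (d : ℕ) :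
    X.age ω n d + X.delta ω d ≤ sys.Tmax := by
  have h1 := h.decisionPoint_succ_le n d
  rw [start_succ] at h1
  have h2 := (h n (X.current ω n d)).2
  have h3 := sys.frameMax_le_Tmax n
  simp only [age, delta]
  linarith

theorem age_le (h : X.RegularAt ω) (n : Fin N) (d : ℕ) : X.age ω n d ≤ sys.Tmax := by
  linarith [h.age_add_delta_le n d, h.delta_pos d]

theorem delta_le (h : X.RegularAt ω) (d : ℕ) : X.delta ω d ≤ sys.Tmax := by
  linarith [h.age_add_delta_le 0 d, h.age_nonneg 0 d]

theorem age_succ (h : X.RegularAt ω) (n : Fin N) (d : ℕ) :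
    X.age ω n (d + 1) = X.age ω n d + X.delta ω d ∨ X.age ω n (d + 1) = 0 := by
  rcases h.current_succ n d with ⟨-, hc⟩ | ⟨ht, hc⟩
  · left
    simp only [age, delta, hc]
    ring
  · right
    simp only [age, hc, ht, sub_self]

/-- Each decision point is the beginning of a frame, so `d` of them complete `d` frames in all. -/
theorem le_sum_current (h : X.RegularAt ω) (d : ℕ) : d ≤ ∑ n, X.current ω n d := by
  induction d with
  | zero => exact Nat.zero_le _
  | succ d ih =>
    obtain ⟨⟨n, k, hk⟩, hlt⟩ := (h.decisionPoint_nonneg_and_isLeast d).2.1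
    refine Nat.succ_le_of_lt (ih.trans_lt (Finset.sum_lt_sum (fun m _ => ?_)
      ⟨n, Finset.mem_univ n, ?_⟩))
    · rcases h.current_succ m d with ⟨-, hc⟩ | ⟨-, hc⟩ <;> omega
    · rcases h.current_succ n d with ⟨hl, -⟩ | ⟨-, hc⟩
      · have h1 : X.current ω n d + 1 ≤ k := (h.start_strictMono n).lt_iff_lt.1
          ((h.start_current_le n d).trans_lt (by rw [← hk]; exact hlt))
        have h2 := X.start_mono n ω h1
        simp only [← hk] at h2
        linarith
      · omega

theorem tendsto_decisionPoint (h : X.RegularAt ω) : Tendsto (X.decisionPoint ω) atTop atTop := by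
  have hc : 0 < ∑ n, (sys.frameMin n)⁻¹ :=
    Finset.sum_pos (fun n _ => inv_pos.2 (sys.frameMin_pos n)) Finset.univ_nonempty
  have hle : ∀ d : ℕ, (d : ℝ) / ∑ n, (sys.frameMin n)⁻¹ ≤ X.decisionPoint ω d := by
    intro d
    rw [div_le_iff₀ hc, Finset.mul_sum]
    have h1 : (d : ℝ) ≤ ∑ n, (X.current ω n d : ℝ) := by exact_mod_cast h.le_sum_current d
    refine h1.trans (Finset.sum_le_sum fun n _ => ?_)
    rw [← div_eq_mul_inv, le_div_iff₀ (sys.frameMin_pos n)]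
    exact (h.mul_frameMin_le_start n _).trans (h.start_current_le n d)
  exact tendsto_atTop_mono hle (tendsto_natCast_atTop_atTop.atTop_div_const hc)

theorem tendsto_current (h : X.RegularAt ω) (n : Fin N) :
    Tendsto (X.current ω n) atTop atTop := by
  have h1 : ∀ d, X.decisionPoint ω d / sys.frameMax n - 1 ≤ (X.current ω n d : ℝ) := by
    intro d
    rw [sub_le_iff_le_add, div_le_iff₀ (h.frameMax_pos n)]
    have := (h.lt_start_current_succ n d).le.trans (h.start_le_mul_frameMax n _)
    exact_mod_cast this
  refine tendsto_natCast_atTop_iff.1 (tendsto_atTop_mono h1 ?_)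
  exact tendsto_atTop_add_const_right _ _ (h.tendsto_decisionPoint.atTop_div_const (h.frameMax_pos n))

/-- Integrating over `[0, t_D]` a rate that is constant on the frames of a site. -/
theorem sum_delta_mul (h : X.RegularAt ω) (n : Fin N) (r : ℕ → ℝ) (D : ℕ) :
    ∑ d ∈ Finset.range D, X.delta ω d * r (X.current ω n d)
      = ∑ k ∈ Finset.range (X.current ω n D), r k * (X.Tad n k ω + X.Tfr n k ω)
        + r (X.current ω n D) * X.age ω n D := by
  induction D with
  | zero => simp [h.current_zero, h.age_zero]
  | succ D ih =>
    rw [Finset.sum_range_succ, ih]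
    rcases h.current_succ n D with ⟨-, hc⟩ | ⟨ht, hc⟩
    · simp only [age, delta, hc]
      ring
    · rw [start_succ] at ht
      simp only [age, delta, hc, Finset.sum_range_succ, start_succ, ht]
      ring

/-- If the rate `r` accrues over the frames of a site the same average as the rewards `f`, then the
time average of the rate is the average reward per average frame length. -/
theorem tendsto_sum_delta_mul (h : X.RegularAt ω) (n : Fin N) {r f : ℕ → ℝ} {c a τ : ℝ}
    (hr : ∀ k, |r k| ≤ c)
    (hrf : Tendsto (fun K : ℕ => (1 / (K : ℝ)) * ∑ k ∈ Finset.range K,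
      (r k * (X.Tad n k ω + X.Tfr n k ω) - f k)) atTop (𝓝 0))
    (hf : Tendsto (fun K : ℕ => (1 / (K : ℝ)) * ∑ k ∈ Finset.range K, f k) atTop (𝓝 a))
    (hτ : Tendsto (fun K : ℕ => (1 / (K : ℝ)) * ∑ k ∈ Finset.range K,
      (X.Tad n k ω + X.Tfr n k ω)) atTop (𝓝 τ)) (hτ0 : τ ≠ 0) :
    Tendsto (fun D => (∑ d ∈ Finset.range D, X.delta ω d * r (X.current ω n d))
      / X.decisionPoint ω D) atTop (𝓝 (a / τ)) := by
  have hK := h.tendsto_current n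
  have hinv : Tendsto (fun D => 1 / (X.current ω n D : ℝ)) atTop (𝓝 0) :=
    tendsto_one_div_atTop_nhds_zero_nat.comp hK
  -- the incomplete last frame contributes nothing in the limit
  have hage : ∀ b : ℕ → ℝ, (∃ C, ∀ k, |b k| ≤ C) → Tendsto (fun D =>
      (1 / (X.current ω n D : ℝ)) * (b (X.current ω n D) * X.age ω n D)) atTop (𝓝 0) := by
    rintro b ⟨C, hC⟩
    refine hinv.zero_mul_isBoundedUnder_le (isBoundedUnder_of ⟨C * sys.Tmax, fun D => ?_⟩)
    simp only [Function.comp, norm_mul, Real.norm_eq_abs]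
    rw [abs_of_nonneg (h.age_nonneg n D)]
    exact mul_le_mul (hC _) (h.age_le n D) (h.age_nonneg n D) ((abs_nonneg _).trans (hC 0))
  have hnum : Tendsto (fun D => (1 / (X.current ω n D : ℝ)) *
      ∑ d ∈ Finset.range D, X.delta ω d * r (X.current ω n d)) atTop (𝓝 a) := by
    have h1 := ((hrf.add hf).comp hK).add (hage r ⟨c, hr⟩)
    rw [zero_add, add_zero] at h1
    refine h1.congr fun D => ?_
    simp only [Function.comp]
    rw [h.sum_delta_mul, ← mul_add, ← Finset.sum_add_distrib, ← mul_add]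
    simp
  have hden : Tendsto (fun D => (1 / (X.current ω n D : ℝ)) * X.decisionPoint ω D) atTop
      (𝓝 τ) := by
    have h1 := (hτ.comp hK).add (hage (fun _ => 1) ⟨1, fun _ => by simp⟩)
    rw [add_zero] at h1
    refine h1.congr fun D => ?_
    simp only [Function.comp]
    rw [← mul_add]
    simp only [age, start, frameStart]
    ring
  refine (hnum.div hden hτ0).congr' ?_
  filter_upwards [hK.eventually_ge_atTop 1] with D hD
  have : (0 : ℝ) < X.current ω n D := by exact_mod_cast hD
  exact mul_div_mul_left _ _ (by positivity)

end RegularAt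

end AdProcess

/-! ### The deficit queue -/

namespace AdSystem

variable {N : ℕ} {Cfg : Fin N → Type u} [∀ n, MeasurableSpace (Cfg n)] (sys : AdSystem N Cfg)

/-- The rate `x` satisfies every Lagrangian upper bound on the time average revenue: for a price
`q ≥ 0` of the budget, `V x - q B_av` is at most the sum over the sites of any upper bounds on the
objectives `Ψₙ` at deficit `q`. -/
def IsDualBounded (V x : ℝ) : Prop :=
  ∀ q, 0 ≤ q → ∀ ψ : Fin N → ℝ,
    (∀ n p T (m : Cfg n), (p, T) ∈ sys.actions n → sys.Psi n V q p T m ≤ ψ n) →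
      V * x ≤ ∑ n, ψ n + q * sys.budget

theorem Psi_sub_Psi (n : Fin N) (V q q' p T : ℝ) (m : Cfg n) :
    sys.Psi n V q p T m = sys.Psi n V q' p T m - (q - q') * (p / (sys.F n p m + T)) := by
  simp only [Psi]
  ring

end AdSystem

namespace AdProcess

variable {N : ℕ} {Cfg : Fin N → Type u} [∀ n, MeasurableSpace (Cfg n)] {sys : AdSystem N Cfg}
  {Ω : Type v} [mΩ : MeasurableSpace Ω] {P : Measure Ω} (X : AdProcess sys P) {ω : Ω}

theorem Psi_eq (n : Fin N) (V q : ℝ) (k : ℕ) (ω : Ω) :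
    sys.Psi n V q (X.p n k ω) (X.Tfr n k ω) (X.cfg n k ω)
      = V * X.revRate n k ω - q * X.spendRate n k ω := by
  simp only [AdSystem.Psi, revRate, spendRate, meanRev, meanTad]
  ring

/-- The total rate at which the current frames consume budget at `t_d`. -/
noncomputable def totalSpendRate (ω : Ω) (d : ℕ) : ℝ :=
  ∑ n, X.spendRate n (X.current ω n d) ω

theorem totalSpendRate_nonneg (ω : Ω) (d : ℕ) : 0 ≤ X.totalSpendRate ω d :=
  Finset.sum_nonneg fun n _ => X.spendRate_nonneg n _ ω

theorem totalSpendRate_le (ω : Ω) (d : ℕ) : X.totalSpendRate ω d ≤ sys.maxRate :=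
  Finset.sum_le_sum fun n _ => X.spendRate_le n _ ω

theorem Q_succ (ω : Ω) (d : ℕ) :
    X.Q ω (d + 1) = max (X.Q ω d - X.delta ω d * sys.budget) 0
      + X.delta ω d * X.totalSpendRate ω d := rfl

theorem le_Q_succ (ω : Ω) (d : ℕ) :
    X.Q ω d - X.delta ω d * sys.budget + X.delta ω d * X.totalSpendRate ω d ≤ X.Q ω (d + 1) := by
  rw [Q_succ]
  linarith [le_max_left (X.Q ω d - X.delta ω d * sys.budget) 0]

theorem sum_delta (ω : Ω) (D : ℕ) :
    ∑ d ∈ Finset.range D, X.delta ω d = X.decisionPoint ω D := by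
  simp only [delta, Finset.sum_range_sub]
  simp [decisionPoint]

theorem sum_delta_mul_totalSpendRate_le (ω : Ω) (D : ℕ) :
    ∑ d ∈ Finset.range D, X.delta ω d * X.totalSpendRate ω d
      ≤ sys.budget * X.decisionPoint ω D + X.Q ω D := by
  induction D with
  | zero => simp [decisionPoint, Q]
  | succ D ih =>
    rw [Finset.sum_range_succ]
    have := X.le_Q_succ ω D
    simp only [delta] at this ih ⊢
    linarith

/-- The Lyapunov function: half the squared deficit, plus the age potentials of the sites. -/
noncomputable def lyapunov [NeZero N] (ω : Ω) (d : ℕ) : ℝ :=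
  X.Q ω d ^ 2 / 2 + max sys.maxRate sys.budget / 2 * ∑ n, sys.pMax n / sys.frameMin n *
    (X.age ω n d * (sys.Tmax - X.age ω n d))

/-- At every decision point of the path `ω`, the sites that begin a frame follow Ad-Investment. -/
def FollowsAdInvestmentAt (V : ℝ) (ω : Ω) : Prop :=
  ∀ d n, (∃ j, X.start n j ω = X.decisionPoint ω d) →
    ∀ p T (m : Cfg n), (p, T) ∈ sys.actions n →
      sys.Psi n V (X.Q ω d) p T m
        ≤ V * X.revRate n (X.current ω n d) ω - X.Q ω d * X.spendRate n (X.current ω n d) ω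

theorem IsAdInvestment.ae_followsAt {X : AdProcess sys P} {V : ℝ} (h : X.IsAdInvestment V) :
    ∀ᵐ ω ∂P, X.FollowsAdInvestmentAt V ω := by
  filter_upwards [h] with ω hω d n hj p T m hp
  exact (hω d n hj p T m hp).trans_eq (X.Psi_eq n V _ _ ω)

/-- A frame that begins while the deficit exceeds `V ν` gets no investment, as every investment
would make the objective negative. -/
theorem FollowsAdInvestmentAt.spendRate_eq_zero {X : AdProcess sys P} {V : ℝ} (hV : 0 ≤ V)
    (hAI : X.FollowsAdInvestmentAt V ω) {n : Fin N} {e : ℕ}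
    (he : ∃ j, X.start n j ω = X.decisionPoint ω e) (hQ : V * sys.nu < X.Q ω e) :
    X.spendRate n (X.current ω n e) ω = 0 := by
  set k := X.current ω n e
  obtain ⟨T, hT, h0⟩ := sys.exists_Psi_eq_zero n V (X.Q ω e) (X.cfg n k ω)
  have h1 := hAI e n he 0 T (X.cfg n k ω) hT
  rw [h0] at h1
  have h2 : X.revRate n k ω ≤ sys.nu * X.spendRate n k ω := X.revRate_le_nu_mul n k ω
  have h3 := mul_le_mul_of_nonneg_left h2 hV
  have h4 := X.spendRate_nonneg n k ω
  by_contra hne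
  have h5 : 0 < X.spendRate n k ω := lt_of_le_of_ne h4 (Ne.symm hne)
  have h6 := mul_lt_mul_of_pos_right hQ h5
  linarith

namespace RegularAt

variable {X} [NeZero N]

theorem Q_nonneg (h : X.RegularAt ω) (d : ℕ) : 0 ≤ X.Q ω d := by
  cases d with
  | zero => exact le_rfl
  | succ d =>
    rw [Q_succ]
    exact add_nonneg (le_max_right _ _)
      (mul_nonneg (h.delta_pos d).le (X.totalSpendRate_nonneg ω d))

theorem Q_succ_le (h : X.RegularAt ω) (d : ℕ) :
    X.Q ω (d + 1) ≤ X.Q ω d + X.delta ω d * X.totalSpendRate ω d := by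
  rw [Q_succ]
  have h1 := mul_nonneg (h.delta_pos d).le sys.budget_nonneg
  linarith [max_le (sub_le_self (X.Q ω d) h1) (h.Q_nonneg d)]

/-- The deficit changes at most at the rate `max (∑ₙ pₙᵐᵃˣ / Tₙᵐⁱⁿ) B_av`. -/
theorem abs_Q_sub_le (h : X.RegularAt ω) {e d : ℕ} (hed : e ≤ d) :
    |X.Q ω d - X.Q ω e|
      ≤ max sys.maxRate sys.budget * (X.decisionPoint ω d - X.decisionPoint ω e) := by
  induction d, hed using Nat.le_induction with
  | base => simp
  | succ d hed ih =>
    have hδ := (h.delta_pos d).le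
    have h1 := h.Q_succ_le d
    have h2 := X.le_Q_succ ω d
    have h3 : X.delta ω d * X.totalSpendRate ω d ≤ X.delta ω d * max sys.maxRate sys.budget :=
      mul_le_mul_of_nonneg_left ((X.totalSpendRate_le ω d).trans (le_max_left _ _)) hδ
    have h4 : X.delta ω d * sys.budget ≤ X.delta ω d * max sys.maxRate sys.budget :=
      mul_le_mul_of_nonneg_left (le_max_right _ _) hδ
    have h5 := mul_nonneg hδ (X.totalSpendRate_nonneg ω d)
    have h6 : max sys.maxRate sys.budget * (X.decisionPoint ω (d + 1) - X.decisionPoint ω e)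
        = max sys.maxRate sys.budget * (X.decisionPoint ω d - X.decisionPoint ω e)
          + X.delta ω d * max sys.maxRate sys.budget := by
      simp only [delta]
      ring
    rw [h6, abs_le]
    constructor <;> linarith [(abs_le.1 ih).1, (abs_le.1 ih).2]

theorem sq_Q_succ_le (h : X.RegularAt ω) (d : ℕ) :
    X.Q ω (d + 1) ^ 2 ≤ X.Q ω d ^ 2 + X.delta ω d ^ 2 * (sys.maxRate ^ 2 + sys.budget ^ 2)
      + 2 * (X.delta ω d * (X.Q ω d * (X.totalSpendRate ω d - sys.budget))) := by
  have hQ := h.Q_nonneg d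
  have hδ := (h.delta_pos d).le
  have hA := X.totalSpendRate_nonneg ω d
  have hA2 : X.totalSpendRate ω d ^ 2 ≤ sys.maxRate ^ 2 :=
    pow_le_pow_left₀ hA (X.totalSpendRate_le ω d) 2
  rw [Q_succ]
  set m := max (X.Q ω d - X.delta ω d * sys.budget) 0 with hm
  have h1 : m ^ 2 ≤ (X.Q ω d - X.delta ω d * sys.budget) ^ 2 := by
    rcases max_choice (X.Q ω d - X.delta ω d * sys.budget) 0 with h0 | h0 <;> rw [hm, h0]
    simpa using sq_nonneg _
  have h2 : m ≤ X.Q ω d :=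
    max_le (sub_le_self _ (mul_nonneg hδ sys.budget_nonneg)) hQ
  have h3 := mul_le_mul_of_nonneg_right h2 (mul_nonneg hδ hA)
  have h4 := mul_le_mul_of_nonneg_left hA2 (sq_nonneg (X.delta ω d))
  nlinarith

/-- The action of the current frame of a site was optimal for the deficit at the beginning of the
frame; it is optimal for the present deficit up to an error proportional to the age of the frame. -/
theorem Psi_le_current (h : X.RegularAt ω) {V : ℝ} (hAI : X.FollowsAdInvestmentAt V ω)
    (d : ℕ) (n : Fin N) {p T : ℝ} (m : Cfg n) (hp : (p, T) ∈ sys.actions n) :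
    sys.Psi n V (X.Q ω d) p T m ≤ V * X.revRate n (X.current ω n d) ω
      - X.Q ω d * X.spendRate n (X.current ω n d) ω
      + max sys.maxRate sys.budget * X.age ω n d * (sys.pMax n / sys.frameMin n) := by
  obtain ⟨e, hed, hte, hce⟩ := h.exists_start_current n d
  have h1 := hAI e n ⟨_, hte.symm⟩ p T m hp
  rw [hce] at h1
  rw [sys.Psi_sub_Psi n V (X.Q ω d) (X.Q ω e)]
  have h2 := h.abs_Q_sub_le hed
  have h3 : X.decisionPoint ω d - X.decisionPoint ω e = X.age ω n d := by rw [hte, age]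
  rw [h3] at h2
  have h4 : |X.spendRate n (X.current ω n d) ω - p / (sys.F n p m + T)|
      ≤ sys.pMax n / sys.frameMin n :=
    abs_sub_le_of_nonneg_of_le (X.spendRate_nonneg n _ ω) (X.spendRate_le n _ ω)
      (sys.rate_nonneg m hp) (sys.rate_le m hp)
  have h5 : (X.Q ω d - X.Q ω e) * (X.spendRate n (X.current ω n d) ω - p / (sys.F n p m + T))
      ≤ max sys.maxRate sys.budget * X.age ω n d * (sys.pMax n / sys.frameMin n) := by
    refine (le_abs_self _).trans ?_
    rw [abs_mul]
    exact mul_le_mul h2 h4 (abs_nonneg _) ((abs_nonneg _).trans h2)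
  linarith

/-- The age potential `age (Tᵐᵃˣ - age)` pays for the staleness of the deficit used by a site. -/
theorem age_potential (h : X.RegularAt ω) (n : Fin N) (d : ℕ) :
    2 * (X.delta ω d * X.age ω n d) + X.delta ω d ^ 2
      ≤ sys.Tmax * X.delta ω d + X.age ω n d * (sys.Tmax - X.age ω n d)
        - X.age ω n (d + 1) * (sys.Tmax - X.age ω n (d + 1)) := by
  rcases h.age_succ n d with h1 | h1
  · rw [h1]
    exact le_of_eq (by ring)
  · rw [h1]
    have h2 := h.age_add_delta_le n d
    have h3 := h.age_nonneg n d
    have h4 := (h.delta_pos d).le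
    nlinarith [mul_le_mul_of_nonneg_left h2 (add_nonneg h3 h4)]

theorem lyapunov_nonneg (h : X.RegularAt ω) (d : ℕ) : 0 ≤ X.lyapunov ω d := by
  refine add_nonneg (by positivity) (mul_nonneg ?_ (Finset.sum_nonneg fun n _ =>
    mul_nonneg (sys.pMax_div_nonneg n)
      (mul_nonneg (h.age_nonneg n d) (sub_nonneg.2 (h.age_le n d)))))
  exact div_nonneg (sys.budget_nonneg.trans (le_max_right _ _)) zero_le_two

/-- One step of the drift-plus-penalty bound. -/
theorem drift_le (h : X.RegularAt ω) {V x : ℝ} (hAI : X.FollowsAdInvestmentAt V ω)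
    (hx : sys.IsDualBounded V x) (d : ℕ) :
    X.delta ω d * (V * x) + X.lyapunov ω (d + 1) - X.lyapunov ω d
      ≤ V * (X.delta ω d * ∑ n, X.revRate n (X.current ω n d) ω)
        + X.delta ω d * (sys.Tmax / 2 * (sys.maxRate ^ 2 + sys.budget ^ 2)) := by
  set δ := X.delta ω d with hδdef
  set M := max sys.maxRate sys.budget with hM
  have hδ : 0 ≤ δ := (h.delta_pos d).le
  have hM0 : 0 ≤ M := sys.budget_nonneg.trans (le_max_right _ _)
  have hr0 := sys.maxRate_nonneg
  have hB0 := sys.budget_nonneg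
  have h1 := hx (X.Q ω d) (h.Q_nonneg d) _ fun n p T m hp => h.Psi_le_current hAI d n m hp
  rw [Finset.sum_add_distrib, Finset.sum_sub_distrib, ← Finset.mul_sum, ← Finset.mul_sum,
    ← totalSpendRate] at h1
  have h2 := mul_le_mul_of_nonneg_left h1 hδ
  have h3 := h.sq_Q_succ_le d
  have h4 : ∑ n, sys.pMax n / sys.frameMin n * (2 * (δ * X.age ω n d) + δ ^ 2)
      ≤ ∑ n, sys.pMax n / sys.frameMin n * (sys.Tmax * δ
        + X.age ω n d * (sys.Tmax - X.age ω n d)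
        - X.age ω n (d + 1) * (sys.Tmax - X.age ω n (d + 1))) :=
    Finset.sum_le_sum fun n _ =>
      mul_le_mul_of_nonneg_left (h.age_potential n d) (sys.pMax_div_nonneg n)
  have e1 : ∑ n, sys.pMax n / sys.frameMin n * (2 * (δ * X.age ω n d) + δ ^ 2)
      = 2 * (δ * ∑ n, X.age ω n d * (sys.pMax n / sys.frameMin n)) + δ ^ 2 * sys.maxRate := by
    simp only [AdSystem.maxRate, Finset.mul_sum, ← Finset.sum_add_distrib]
    exact Finset.sum_congr rfl fun n _ => by ring
  have e2 : ∑ n, sys.pMax n / sys.frameMin n * (sys.Tmax * δ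
        + X.age ω n d * (sys.Tmax - X.age ω n d)
        - X.age ω n (d + 1) * (sys.Tmax - X.age ω n (d + 1)))
      = sys.Tmax * δ * sys.maxRate
        + ∑ n, sys.pMax n / sys.frameMin n * (X.age ω n d * (sys.Tmax - X.age ω n d))
        - ∑ n, sys.pMax n / sys.frameMin n
          * (X.age ω n (d + 1) * (sys.Tmax - X.age ω n (d + 1))) := by
    simp only [AdSystem.maxRate, Finset.mul_sum, ← Finset.sum_add_distrib,
      ← Finset.sum_sub_distrib]
    exact Finset.sum_congr rfl fun n _ => by ring
  have e3 : ∑ n, M * X.age ω n d * (sys.pMax n / sys.frameMin n)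
      = M * ∑ n, X.age ω n d * (sys.pMax n / sys.frameMin n) := by
    rw [Finset.mul_sum]
    exact Finset.sum_congr rfl fun n _ => by ring
  rw [e1, e2] at h4
  rw [e3] at h2
  have h5 := mul_le_mul_of_nonneg_left h4 (div_nonneg hM0 zero_le_two)
  -- the drift error decreases and the staleness error increases as the steps get finer; the
  -- balance is settled by `r max(r, B) ≤ r² + B²` and `δ ≤ Tᵐᵃˣ`
  have h6 : sys.maxRate * M ≤ sys.maxRate ^ 2 + sys.budget ^ 2 := by
    rcases max_choice sys.maxRate sys.budget with h0 | h0 <;> rw [hM, h0] <;>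
      nlinarith [sq_nonneg (sys.maxRate - sys.budget), sq_nonneg sys.maxRate, sq_nonneg sys.budget]
  have h7 : 0 ≤ (sys.maxRate ^ 2 + sys.budget ^ 2 - sys.maxRate * M) * (δ * (sys.Tmax - δ)) :=
    mul_nonneg (sub_nonneg.2 h6) (mul_nonneg hδ (sub_nonneg.2 (h.delta_le d)))
  simp only [lyapunov, ← hM]
  linarith

theorem mul_decisionPoint_le (h : X.RegularAt ω) {V x : ℝ} (hAI : X.FollowsAdInvestmentAt V ω)
    (hx : sys.IsDualBounded V x) (D : ℕ) :
    (V * x - sys.Tmax / 2 * (sys.maxRate ^ 2 + sys.budget ^ 2)) * X.decisionPoint ω D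
      ≤ V * ∑ d ∈ Finset.range D, X.delta ω d * ∑ n, X.revRate n (X.current ω n d) ω := by
  have h1 := Finset.sum_le_sum fun d (_ : d ∈ Finset.range D) => h.drift_le hAI hx d
  simp only [add_sub_assoc, Finset.sum_add_distrib, ← Finset.sum_mul, ← Finset.mul_sum,
    Finset.sum_range_sub, sum_delta] at h1
  have h2 := h.lyapunov_nonneg D
  have h3 : X.lyapunov ω 0 = 0 := by simp [lyapunov, h.age_zero, Q]
  linarith

theorem Q_le (h : X.RegularAt ω) {V : ℝ} (hV : 0 ≤ V) (hAI : X.FollowsAdInvestmentAt V ω) (d : ℕ) :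
    X.Q ω d ≤ V * sys.nu + 2 * sys.cMax := by
  have hT : 0 ≤ sys.Tmax := (h.age_nonneg 0 0).trans (h.age_le 0 0)
  have hr := sys.maxRate_nonneg
  have hc : sys.Tmax * sys.maxRate ≤ sys.cMax := mul_le_mul_of_nonneg_left (le_max_left _ _) hT
  have hc0 : 0 ≤ sys.cMax := (mul_nonneg hT hr).trans hc
  -- `e` is the last decision point up to `d` at which the deficit is at most `V ν`
  have key : ∃ e ≤ d, (∀ i, e < i → i ≤ d → V * sys.nu < X.Q ω i) ∧
      X.Q ω d ≤ V * sys.nu + sys.maxRate * (X.decisionPoint ω d - X.decisionPoint ω e) ∧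
      X.Q ω d ≤ V * sys.nu + 2 * sys.cMax := by
    induction d with
    | zero =>
      have h0 : X.Q ω 0 = 0 := rfl
      have h1 := mul_nonneg hV sys.nu_nonneg
      exact ⟨0, le_rfl, by omega, by rw [h0]; simpa using h1, by rw [h0]; linarith⟩
    | succ d ih =>
      obtain ⟨e, hed, habove, hlin, hbd⟩ := ih
      rcases le_or_gt (X.Q ω (d + 1)) (V * sys.nu) with hle | hgt
      · exact ⟨d + 1, le_rfl, by omega, by simpa using hle, by linarith⟩
      have hstep : X.Q ω (d + 1)
          ≤ V * sys.nu + sys.maxRate * (X.decisionPoint ω (d + 1) - X.decisionPoint ω e) := by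
        have h1 := h.Q_succ_le d
        have h2 := mul_le_mul_of_nonneg_left (X.totalSpendRate_le ω d) (h.delta_pos d).le
        simp only [delta] at h1 h2
        linarith
      refine ⟨e, by omega, fun i hi hid => ?_, hstep, ?_⟩
      · rcases Nat.lt_or_eq_of_le hid with h1 | h1
        · exact habove i hi (by omega)
        · rw [h1]; exact hgt
      rcases lt_or_ge (X.decisionPoint ω d - X.decisionPoint ω e) sys.Tmax with hnear | hfar
      · have h1 := h.delta_le d
        simp only [delta] at h1
        have h2 : sys.maxRate * (X.decisionPoint ω (d + 1) - X.decisionPoint ω e)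
            ≤ sys.maxRate * (2 * sys.Tmax) := mul_le_mul_of_nonneg_left (by linarith) hr
        linarith
      · -- all current frames began after `t_e`, hence without investment
        have hzero : X.totalSpendRate ω d = 0 := by
          refine Finset.sum_eq_zero fun n _ => ?_
          obtain ⟨i, hid, hti, hci⟩ := h.exists_start_current n d
          have h1 : X.age ω n d < sys.Tmax := by
            linarith [h.age_add_delta_le n d, h.delta_pos d]
          have h2 : e < i := by
            refine h.decisionPoint_strictMono.lt_iff_lt.1 ?_
            simp only [age] at h1
            linarith
          rw [← hci]
          exact hAI.spendRate_eq_zero hV ⟨_, hti.symm⟩ (habove i h2 hid)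
        have h1 := h.Q_succ_le d
        rw [hzero, mul_zero, add_zero] at h1
        exact h1.trans hbd
  exact key.choose_spec.2.2.2

end RegularAt

end AdProcess

/-! ### Time averages and the Lagrangian bound on feasible strategies -/

theorem HasTimeAverage.tendsto {f : ℕ → ℝ} (h : HasTimeAverage f) :
    Tendsto (fun K : ℕ => (1 / (K : ℝ)) * ∑ k ∈ Finset.range K, f k) atTop
      (𝓝 (timeAverage f)) := by
  obtain ⟨a, ha⟩ := h
  rwa [timeAverage, ha.limUnder_eq]

namespace AdProcess

variable {N : ℕ} {Cfg : Fin N → Type u} [∀ n, MeasurableSpace (Cfg n)] {sys : AdSystem N Cfg}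
  {Ω : Type v} [mΩ : MeasurableSpace Ω] {P : Measure Ω} (X : AdProcess sys P) {ω : Ω}

variable {X} in
theorem RegularAt.timeAverage_frame_pos (h : X.RegularAt ω) {n : Fin N}
    (hτ : HasTimeAverage fun k => X.Tad n k ω + X.Tfr n k ω) :
    0 < timeAverage fun k => X.Tad n k ω + X.Tfr n k ω := by
  refine (sys.frameMin_pos n).trans_le (ge_of_tendsto hτ.tendsto ?_)
  filter_upwards [eventually_ge_atTop 1] with K hK
  have hK0 : (0 : ℝ) < K := by exact_mod_cast hK
  rw [one_div, inv_mul_eq_div, le_div_iff₀ hK0, mul_comm]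
  exact h.mul_frameMin_le_start n K

/-- For every price `q` of the budget, the time averages at a site of any strategy obey the bound
`V R̄ - q p̄ ≤ ψ T̄` that holds in the mean for each frame. -/
theorem ae_timeAverage_le [IsProbabilityMeasure P] (n : Fin N) {V q ψ : ℝ}
    (hψ : ∀ p T (m : Cfg n), (p, T) ∈ sys.actions n → sys.Psi n V q p T m ≤ ψ) :
    ∀ᵐ ω ∂P, X.LimitsExist ω → V * timeAverage (fun k => X.R n k ω)
      - q * timeAverage (fun k => X.p n k ω)
        ≤ ψ * timeAverage (fun k => X.Tad n k ω + X.Tfr n k ω) := by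
  filter_upwards [X.ae_tendsto_average_R_sub n,
    X.ae_tendsto_average_mul_Tad_sub n (w := fun _ _ => 1) (c := 1) (fun _ => measurable_const)
      (by simp)] with ω hR hT hω
  obtain ⟨h1, h2, h3⟩ := hω n
  have hl := ((h1.tendsto.sub hR).const_mul V).sub (h2.tendsto.const_mul q)
  have hr := (h3.tendsto.sub hT).const_mul ψ
  rw [sub_zero] at hl hr
  refine le_of_tendsto_of_tendsto hl hr (Eventually.of_forall fun K => ?_)
  have hk : ∀ k, V * X.meanRev n k ω - q * X.p n k ω ≤ ψ * (X.meanTad n k ω + X.Tfr n k ω) := by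
    intro k
    have := hψ _ _ (X.cfg n k ω) (X.feasible n k ω)
    exact (div_le_iff₀ (X.meanFrame_pos n k ω)).1 this
  have hsum := mul_le_mul_of_nonneg_left (Finset.sum_le_sum fun k (_ : k ∈ Finset.range K) => hk k)
    (show (0 : ℝ) ≤ 1 / K by positivity)
  simp only [Finset.sum_sub_distrib, Finset.sum_add_distrib, ← Finset.mul_sum, one_mul] at hsum ⊢
  linarith

/-- Weak Lagrangian duality: a price `q ≥ 0` of the budget and bounds on the objectives at that price
bound the time average revenue of a feasible strategy. -/
theorem ae_profit_le [IsProbabilityMeasure P] (hX : X.IsFeasible) {V q : ℝ} (hq : 0 ≤ q)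
    {ψ : Fin N → ℝ}
    (hψ : ∀ n p T (m : Cfg n), (p, T) ∈ sys.actions n → sys.Psi n V q p T m ≤ ψ n) :
    ∀ᵐ ω ∂P, V * X.profit ω ≤ ∑ n, ψ n + q * sys.budget := by
  filter_upwards [hX, X.ae_regularAt, ae_all_iff.2 fun n => X.ae_timeAverage_le n (hψ n)]
    with ω ⟨hlim, hexp⟩ hreg hle
  have h1 : V * X.profit ω - q * X.expenditure ω ≤ ∑ n, ψ n := by
    simp only [profit, expenditure, Finset.mul_sum]
    rw [← Finset.sum_sub_distrib]
    refine Finset.sum_le_sum fun n _ => ?_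
    rw [← mul_div_assoc, ← mul_div_assoc, ← sub_div,
      div_le_iff₀ (hreg.timeAverage_frame_pos (hlim n).2.2)]
    exact hle n hlim
  have h2 := mul_le_mul_of_nonneg_left hexp hq
  linarith

/-- Upper bounds on the objectives are nonnegative, because of the option not to invest. -/
theorem psi_nonneg [IsProbabilityMeasure P] (X : AdProcess sys P) {V q : ℝ} {ψ : Fin N → ℝ}
    (hψ : ∀ n p T (m : Cfg n), (p, T) ∈ sys.actions n → sys.Psi n V q p T m ≤ ψ n) (n : Fin N) :
    0 ≤ ψ n := by
  obtain ⟨ω⟩ : Nonempty Ω := P.nonempty_of_neZero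
  obtain ⟨T, hT, h0⟩ := sys.exists_Psi_eq_zero n V q (X.cfg n 0 ω)
  rw [← h0]
  exact hψ n 0 T _ hT

theorem isDualBounded_zero [IsProbabilityMeasure P] (X : AdProcess sys P) (V : ℝ) :
    sys.IsDualBounded V 0 := by
  intro q hq ψ hψ
  rw [mul_zero]
  exact add_nonneg (Finset.sum_nonneg fun n _ => X.psi_nonneg hψ n)
    (mul_nonneg hq sys.budget_nonneg)

theorem isDualBounded_integral_profit [IsProbabilityMeasure P] (hX : X.IsFeasible) (V : ℝ) :
    sys.IsDualBounded V (∫ ω, X.profit ω ∂P) := by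
  intro q hq ψ hψ
  by_cases hint : Integrable X.profit P
  · rw [← integral_const_mul]
    have := integral_mono_ae (hint.const_mul V) (integrable_const _) (X.ae_profit_le hX hq hψ)
    simpa using this
  · -- the integral is then zero by convention
    rw [integral_undef hint]
    exact X.isDualBounded_zero V q hq ψ hψ

end AdProcess

namespace AdSystem

variable {N : ℕ} {Cfg : Fin N → Type u} [∀ n, MeasurableSpace (Cfg n)] (sys : AdSystem N Cfg)

theorem isDualBounded_of_mem_achievableProfits {x : ℝ} (hx : x ∈ sys.achievableProfits) (V : ℝ) :
    sys.IsDualBounded V x := by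
  obtain ⟨Ω, _, P, _, X, hX, rfl⟩ := hx
  exact X.isDualBounded_integral_profit hX V

theorem bddAbove_achievableProfits : BddAbove sys.achievableProfits := by
  refine ⟨∑ n, sys.nu * (sys.pMax n / sys.frameMin n), fun x hx => ?_⟩
  have h := sys.isDualBounded_of_mem_achievableProfits hx 1 0 le_rfl
    (fun n => sys.nu * (sys.pMax n / sys.frameMin n)) fun n p T m hp => ?_
  · simpa using h
  · have h1 : sys.Psi n 1 0 p T m ≤ sys.nu * (p / (sys.F n p m + T)) := by
      rw [Psi, one_mul, zero_mul, sub_zero, ← mul_div_assoc]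
      exact div_le_div_of_nonneg_right (sys.mean_revenue n p T m hp).2 (sys.F_add_pos m hp).le
    exact h1.trans (mul_le_mul_of_nonneg_left (sys.rate_le m hp) sys.nu_nonneg)

/-- The drift and staleness errors per unit of time, which add up to
`½ Tᵐᵃˣ ((∑ₙ pₙᵐᵃˣ / Tₙᵐⁱⁿ)² + B_av²)`, are at most `C₀ / Tᵐⁱⁿ`. -/
theorem penalty_le_C0_div [NeZero N] (h : sys.Tmin ≤ sys.Tmax) :
    sys.Tmax / 2 * (sys.maxRate ^ 2 + sys.budget ^ 2) ≤ sys.C0 / sys.Tmin := by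
  have h0 := sys.Tmin_pos
  rw [le_div_iff₀ h0, C0]
  have h1 : 0 ≤ sys.Tmax / 2 * (sys.maxRate ^ 2 + sys.budget ^ 2) :=
    mul_nonneg (by linarith) (by positivity)
  have h2 := mul_le_mul_of_nonneg_left h h1
  linarith

end AdSystem

/-! ### Performance of Ad-Investment -/

namespace AdProcess

variable {N : ℕ} {Cfg : Fin N → Type u} [∀ n, MeasurableSpace (Cfg n)] {sys : AdSystem N Cfg}
  {Ω : Type v} [mΩ : MeasurableSpace Ω] {P : Measure Ω} (X : AdProcess sys P)

/-- The revenue rates of the current frames, averaged over time, converge to the time average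
revenue. -/
theorem ae_tendsto_profit [NeZero N] [IsProbabilityMeasure P] :
    ∀ᵐ ω ∂P, X.LimitsExist ω → Tendsto (fun D =>
      (∑ d ∈ Finset.range D, X.delta ω d * ∑ n, X.revRate n (X.current ω n d) ω)
        / X.decisionPoint ω D) atTop (𝓝 (X.profit ω)) := by
  filter_upwards [X.ae_regularAt, ae_all_iff.2 X.ae_tendsto_average_revRate] with ω hreg hav hlim
  have h := tendsto_finsetSum Finset.univ fun n (_ : n ∈ Finset.univ) =>
    hreg.tendsto_sum_delta_mul n (fun k => by
      rw [abs_of_nonneg (X.revRate_nonneg n k ω)]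
      exact X.revRate_le n k ω) (hav n) (hlim n).1.tendsto (hlim n).2.2.tendsto
      (hreg.timeAverage_frame_pos (hlim n).2.2).ne'
  refine h.congr fun D => ?_
  rw [← Finset.sum_div, Finset.sum_comm]
  simp only [Finset.mul_sum]

/-- The spending rates of the current frames, averaged over time, converge to the time average
expenditure. -/
theorem ae_tendsto_expenditure [NeZero N] [IsProbabilityMeasure P] :
    ∀ᵐ ω ∂P, X.LimitsExist ω → Tendsto (fun D =>
      (∑ d ∈ Finset.range D, X.delta ω d * X.totalSpendRate ω d)
        / X.decisionPoint ω D) atTop (𝓝 (X.expenditure ω)) := by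
  filter_upwards [X.ae_regularAt, ae_all_iff.2 X.ae_tendsto_average_spendRate] with ω hreg hav hlim
  have h := tendsto_finsetSum Finset.univ fun n (_ : n ∈ Finset.univ) =>
    hreg.tendsto_sum_delta_mul n (fun k => by
      rw [abs_of_nonneg (X.spendRate_nonneg n k ω)]
      exact X.spendRate_le n k ω) (hav n) (hlim n).2.1.tendsto (hlim n).2.2.tendsto
      (hreg.timeAverage_frame_pos (hlim n).2.2).ne'
  refine h.congr fun D => ?_
  rw [← Finset.sum_div, Finset.sum_comm]
  simp only [totalSpendRate, Finset.mul_sum]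

end AdProcess

theorem theorem2 {N : ℕ} [NeZero N] {Cfg : Fin N → Type u} [∀ n, MeasurableSpace (Cfg n)]
    (sys : AdSystem N Cfg) (V : ℝ) (hV : 1 ≤ V)
    {Ω : Type v} [MeasurableSpace Ω] (P : Measure Ω) [IsProbabilityMeasure P]
    (X : AdProcess sys P) (hAI : X.IsAdInvestment V) (hlim : ∀ᵐ ω ∂P, X.LimitsExist ω) :
    (BddAbove sys.achievableProfits ∧
      ∀ᵐ ω ∂P, sys.profitStar - sys.C1 / V - sys.C0 / (V * sys.Tmin) ≤ X.profit ω) ∧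
    (∀ᵐ ω ∂P, ∀ d, X.Q ω d ≤ V * sys.nu + 2 * sys.cMax) ∧
    (∀ᵐ ω ∂P, X.expenditure ω ≤ sys.budget) := by
  have hV0 : 0 < V := zero_lt_one.trans_le hV
  refine ⟨⟨sys.bddAbove_achievableProfits, ?_⟩, ?_, ?_⟩
  · filter_upwards [X.ae_regularAt, hAI.ae_followsAt, hlim, X.ae_tendsto_profit]
      with ω hreg hfol hl hprofit
    have hTT : sys.Tmin ≤ sys.Tmax :=
      (Finset.inf'_le sys.frameMin (Finset.mem_univ 0)).trans
        (((hreg 0 0).1.trans (hreg 0 0).2).trans (sys.frameMax_le_Tmax 0))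
    have hC1 : 0 ≤ sys.C1 :=
      mul_nonneg (by linarith [sys.Tmin_pos]) sys.maxRate_nonneg
    have key : ∀ x, sys.IsDualBounded V x →
        x ≤ X.profit ω + sys.C1 / V + sys.C0 / (V * sys.Tmin) := by
      intro x hx
      have h1 : V * x - sys.Tmax / 2 * (sys.maxRate ^ 2 + sys.budget ^ 2) ≤ V * X.profit ω := by
        refine ge_of_tendsto ((hprofit hl).const_mul V) ?_
        filter_upwards [hreg.tendsto_decisionPoint.eventually_gt_atTop 0] with D hD
        rw [← mul_div_assoc, le_div_iff₀ hD]
        exact hreg.mul_decisionPoint_le hfol hx D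
      have h2 := sys.penalty_le_C0_div hTT
      have h3 : V * (X.profit ω + sys.C1 / V + sys.C0 / (V * sys.Tmin))
          = V * X.profit ω + sys.C1 + sys.C0 / sys.Tmin := by
        have := sys.Tmin_pos.ne'
        field_simp
      refine le_of_mul_le_mul_left ?_ hV0
      rw [h3]
      linarith
    -- the supremum of an empty set of profits is zero, which obeys the same bounds
    have hstar : sys.profitStar ≤ X.profit ω + sys.C1 / V + sys.C0 / (V * sys.Tmin) :=
      Real.sSup_le (fun x hx => key x (sys.isDualBounded_of_mem_achievableProfits hx V))
        (key 0 (X.isDualBounded_zero V))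
    linarith
  · filter_upwards [X.ae_regularAt, hAI.ae_followsAt] with ω hreg hfol d
    exact hreg.Q_le hV0.le hfol d
  · filter_upwards [X.ae_regularAt, hAI.ae_followsAt, hlim, X.ae_tendsto_expenditure]
      with ω hreg hfol hl hexp
    have h1 : Tendsto (fun D => sys.budget + (V * sys.nu + 2 * sys.cMax) / X.decisionPoint ω D)
        atTop (𝓝 (sys.budget + 0)) :=
      (hreg.tendsto_decisionPoint.const_div_atTop _).const_add _
    rw [add_zero] at h1
    refine le_of_tendsto_of_tendsto (hexp hl) h1 ?_
    filter_upwards [hreg.tendsto_decisionPoint.eventually_gt_atTop 0] with D hD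
    rw [div_le_iff₀ hD, add_mul, div_mul_cancel₀ _ hD.ne']
    exact (X.sum_delta_mul_totalSpendRate_le ω D).trans
      (by linarith [hreg.Q_le hV0.le hfol D])
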